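/- **Model.** A frequency-estimation sketch processes a stream of keys, inserted one at a time, and stores between operations a bit string, its memory. It may use free randomness (hash functions, fresh coins) and may read for free the number of items processed so far, but it does not know the ultimate length of the stream; no running-time bound is imposed. After a stream $\sigma$ it returns for every key $x$ an estimate $\hat f_\sigma(x)\in\mathbb R$ of the number $f_\sigma(x)$ of occurrences of $x$ in $\sigma$. The sketch has *only overestimation errors* if for all $\sigma$ and $x$, $\hat f_\sigma(x)\ge f_\sigma(x)$ almost surely. It has *error bound $E$ with confidence $1-\delta$* on growing streams if for every stream $\sigma$, of any length $N$, and every key $x$, $\Pr\big[|\hat f_\sigma(x)-f_\sigma(x)|\le E(N)\big]\ge 1-\delta$. **Theorem.** For every $\delta_0<1$ there are constants $c,C,p>0$, depending only on $\delta_0$, such that the following holds. Let $0<\delta\le\delta_0$, let $E:\mathbb N\to[1,\infty)$ be nondecreasing, and consider any frequency-estimation sketch with only overestimation errors and with error bound $E$ and confidence $1-\delta$ on growing streams. Let $N_1$ be a stream length with $E(N_1)<N_1$, and suppose that the universe of keys is infinite or has at least $N_1/\delta$ elements. Then there are a length $N\le N_1$ with $$\frac{N}{E(N)}\ \ge\ \sqrt{\frac{N_1}{E(N_1)}}$$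 and a stream $\sigma$ of length $N$ such that, with probability at least $p$, the memory of the sketch after processing $\sigma$ has at least $$\frac{N}{E(N)}\cdot\Big[\,c\,\Big(\log_2\frac1\delta+\log_2\log_2\frac{N}{E(N)}\Big)-C\,\Big]$$ bits. In particular, if $N/E(N)$ is unbounded and the universe is infinite, then this holds for lengths $N$ with $N/E(N)$ arbitrarily large. -/

import Mathlib

open MeasureTheory

/-- A randomized frequency-estimation sketch for streams of keys from `K`.

`Ω` is the space of random choices (hash functions, fresh coins of every step, coins of the
queries). For a fixed `ω : Ω` the sketch is a deterministic machine whose memory is a bit string: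
`init ω` is the initial memory, `update ω t s x` is the memory after the insertion of `x` as the item
number `t` (counted from `0`) when the memory was `s`, and `query ω t s x` is the estimate returned
for `x` when `t` items have been processed and the memory is `s`.

Only the bit string is charged as memory. The random choices and the number of processed items may
be read for free, and no bound on running time is imposed. The ultimate length of the stream is not
available to any of the three operations. -/
structure FESketch (K : Type*) (Ω : Type*) [MeasurableSpace Ω] where
  init : Ω → List Bool
  update : Ω → ℕ → List Bool → K → List Bool
  query : Ω → ℕ → List Bool → K → ℝ
  measurableSet_init : ∀ s : List Bool, MeasurableSet {ω | init ω = s}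
  measurableSet_update : ∀ (t : ℕ) (s : List Bool) (x : K) (s' : List Bool),
    MeasurableSet {ω | update ω t s x = s'}
  measurable_query : ∀ (t : ℕ) (s : List Bool) (x : K), Measurable fun ω => query ω t s x

namespace FESketch

variable {K Ω : Type*} [MeasurableSpace Ω]

/-- The memory after the items of a list have been inserted in order, when the first of them is the
item number `t` of the stream and the memory before it is `s`. -/
def runFrom (S : FESketch K Ω) (ω : Ω) : ℕ → List Bool → List K → List Bool
  | _, s, [] => s
  | t, s, x :: σ => runFrom S ω (t + 1) (S.update ω t s x) σ

/-- The memory of the sketch after processing the stream `σ` from the beginning. -/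
def memory (S : FESketch K Ω) (ω : Ω) (σ : List K) : List Bool :=
  S.runFrom ω 0 (S.init ω) σ

/-- The number of bits of memory in use after processing the stream `σ`. -/
def bits (S : FESketch K Ω) (ω : Ω) (σ : List K) : ℕ :=
  (S.memory ω σ).length

/-- The estimate of the count of `x` after processing the stream `σ`. -/
def estimate (S : FESketch K Ω) (ω : Ω) (σ : List K) (x : K) : ℝ :=
  S.query ω σ.length (S.memory ω σ) x

/-- Only overestimation errors: after every stream, the estimate of every key is almost surely at
least its count. -/
def NeverUnderestimates [DecidableEq K] (S : FESketch K Ω) (μ : Measure Ω) : Prop :=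
  ∀ (σ : List K) (x : K), ∀ᵐ ω ∂μ, (σ.count x : ℝ) ≤ S.estimate ω σ x

/-- Error bound `E` with confidence `1 - δ`: after every stream, of any length `N`, and for every
key, the estimate differs from the count by at most `E N` with probability at least `1 - δ`. -/
def HasErrorBound [DecidableEq K] (S : FESketch K Ω) (μ : Measure Ω) (E : ℕ → ℝ) (δ : ℝ) : Prop :=
  ∀ (σ : List K) (x : K),
    1 - δ ≤ μ.real {ω | |S.estimate ω σ x - (σ.count x : ℝ)| ≤ E σ.length}

end FESketch

/-! ### Encoding: random symbols confined to small sets force long states -/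

section Encoding

variable {ι α : Type*} [Fintype ι] [Fintype α]

/-! Fix the random choices, so that the sketch is deterministic. A state may be reached by several
histories of the same length. If one of them contains a key `c` times, the estimate of that key is
at least `c`, because estimates depend only on length and state and never underestimate. For a key
absent from the actual stream this is an error of at least `c` (`le_of_reach`). Hence few keys can
be confused, in the sense of having many occurrences in some alternative history. Every key really
inserted often enough is confused, however, since the actual history is a witness. The final state
thus confines random inserted keys to small sets, and a key confined to a set of density `ζ`, and
not already in a set known before it was drawn, is worth about `log (1 / ζ)` bits
(`long_states_of_small_sets`).

For the `log (1 / δ)` term, about `N / E N` random keys are inserted, each more than `E N` times;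
the confused set has density of order `δ`.

For the `log log` term the confidence is only a constant `γ`, and the small sets come from growth.
If `E` at most doubles over a window of `h` dyadic lengths, the stream is cut into `h` phases of
doubling length. The confused set only grows, and grows by at most one universe in total, so a
typical phase adds a fraction of about `1 / h`. With constant probability a new key was not confused
before its phase, and then it is worth about `log h` bits (`long_states_of_many_phases`).

If no such window exists, `E` is large at some length, and the phases are replaced by a tree of
nested time blocks with multiplicities proportional to the block lengths. Confusions in disjoint
blocks add up (`reach_block`), so most keys are confused only for a small fraction of the time,
while the `D` heights share one universe and a typical height adds a fraction of about `1 / D`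
(`long_states_of_tree`).

The dichotomy is `flat_window_or_large`; the number of phases or heights is a fixed power of `log (N
/ E N)`, up to rounding. All these inequalities hold for almost every choice of coins, on average
over random streams. Integrating over the coins yields one fixed stream that does at least as well
as the average (`exists_long_memory`). -/

theorem sum_sum_update [DecidableEq ι] (s : ι) (f : (ι → α) → ℝ) :
    ∑ y, ∑ a, f (Function.update y s a) = Fintype.card α * ∑ y, f y := by
  have hinv : Function.Involutive
      (fun q : (ι → α) × α => (Function.update q.1 s q.2, q.1 s)) := by
    rintro ⟨y, a⟩
    simp
  have h := Equiv.sum_comp hinv.toPerm (fun q : (ι → α) × α => f q.1)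
  rw [Fintype.sum_prod_type, Fintype.sum_prod_type] at h
  simp only [Function.Involutive.coe_toPerm, Finset.sum_const, Finset.card_univ,
    nsmul_eq_mul] at h
  rw [h, Finset.mul_sum]

variable [LinearOrder ι]

theorem sum_indicator_mem_eq [DecidableEq α] [Nonempty α] (s : ι) (Q : (ι → α) → Finset α)
    (hQ : ∀ y y', (∀ i < s, y i = y' i) → Q y = Q y') :
    ∑ y, (if y s ∈ Q y then (1 : ℝ) else 0) = (∑ y, ((Q y).card : ℝ)) / Fintype.card α := by
  have hu : (0 : ℝ) < Fintype.card α := by exact_mod_cast Fintype.card_pos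
  rw [eq_div_iff hu.ne', mul_comm, ← sum_sum_update s]
  refine Finset.sum_congr rfl fun y _ => ?_
  have : ∀ a, Q (Function.update y s a) = Q y := fun a =>
    hQ _ _ fun i hi => Function.update_of_ne hi.ne _ _
  simp [this]

/-- A supermartingale bound. Resampling the symbol at the largest index of `C` leaves all earlier
factors and the last weight function unchanged, so the last factor averages to at most 2 and can be
peeled off. -/
theorem sum_prod_weights_le (C : Finset ι) (W : ι → (ι → α) → α → ℝ)
    (hW : ∀ s y a, 0 ≤ W s y a)
    (hdep : ∀ s y y', (∀ i < s, y i = y' i) → W s y = W s y')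
    (hsum : ∀ s y, ∑ a, W s y a ≤ 2 * Fintype.card α) [Nonempty α] :
    ∑ y, ∏ s ∈ C, W s y (y s) ≤ 2 ^ C.card * Fintype.card (ι → α) := by
  classical
  have hu : (0 : ℝ) < Fintype.card α := by exact_mod_cast Fintype.card_pos
  induction C using Finset.induction_on_max with
  | empty => simp
  | insert s C hlt ih =>
    have hs : s ∉ C := fun h => lt_irrefl _ (hlt s h)
    have key : (Fintype.card α : ℝ) * ∑ y, ∏ i ∈ insert s C, W i y (y i) ≤
        Fintype.card α * (2 * ∑ y, ∏ i ∈ C, W i y (y i)) := by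
      rw [← sum_sum_update s]
      have : ∀ y : ι → α, ∑ a, ∏ i ∈ insert s C, W i (Function.update y s a)
          (Function.update y s a i) ≤ 2 * Fintype.card α * ∏ i ∈ C, W i y (y i) := by
        intro y
        have h1 : ∀ a, ∏ i ∈ insert s C, W i (Function.update y s a) (Function.update y s a i)
            = W s y a * ∏ i ∈ C, W i y (y i) := by
          intro a
          rw [Finset.prod_insert hs]
          congr 1
          · rw [Function.update_self, hdep s _ y fun i hi => Function.update_of_ne hi.ne _ _]
          · refine Finset.prod_congr rfl fun i hi => ?_
            rw [Function.update_of_ne (hlt i hi).ne,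
              hdep i _ y fun j hj => Function.update_of_ne (hj.trans (hlt i hi)).ne _ _]
        simp only [h1, ← Finset.sum_mul]
        exact mul_le_mul_of_nonneg_right (hsum s y) (Finset.prod_nonneg fun i _ => hW _ _ _)
      calc _ ≤ ∑ y, 2 * (Fintype.card α : ℝ) * ∏ i ∈ C, W i y (y i) :=
            Finset.sum_le_sum fun y _ => this y
        _ = _ := by rw [← Finset.mul_sum]; ring
    have key2 := le_of_mul_le_mul_left key hu
    rw [Finset.card_insert_of_notMem hs, pow_succ]
    linarith

/-- Exponential Markov inequality with weight `ζ⁻¹` per hit: a set of density at most `ζ` has mean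
weight at most `ζ * ζ⁻¹ + 1 = 2`. -/
theorem card_many_hits_le [DecidableEq α] [Nonempty α] (C : Finset ι)
    (Z : ι → (ι → α) → Finset α)
    (hZ : ∀ s y y', (∀ i < s, y i = y' i) → Z s y = Z s y')
    (ζ : ℝ) (hζ : 0 < ζ) (hζ1 : ζ ≤ 1) (hcard : ∀ s y, ((Z s y).card : ℝ) ≤ ζ * Fintype.card α)
    (θ : ℝ) :
    (((Finset.univ.filter fun y : ι → α =>
      θ * C.card ≤ ((C.filter fun s => y s ∈ Z s y).card : ℝ)).card : ℕ) : ℝ) ≤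
      2 ^ C.card * ζ ^ (θ * C.card) * Fintype.card (ι → α) := by
  set W : ι → (ι → α) → α → ℝ := fun s y a => if a ∈ Z s y then ζ⁻¹ else 1 with hWdef
  have hW : ∀ s y a, 0 ≤ W s y a := by
    intro s y a
    simp only [hWdef]
    split_ifs <;> positivity
  have hsum : ∀ s y, ∑ a, W s y a ≤ 2 * Fintype.card α := by
    intro s y
    have h1 : ∀ a, W s y a ≤ (if a ∈ Z s y then ζ⁻¹ else 0) + 1 := by
      intro a
      simp only [hWdef]
      split_ifs <;> norm_num
    refine (Finset.sum_le_sum fun a _ => h1 a).trans ?_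
    rw [Finset.sum_add_distrib, ← Finset.sum_filter]
    simp only [Finset.filter_mem_eq_inter, Finset.univ_inter, Finset.sum_const, nsmul_eq_mul,
      Finset.card_univ, mul_one]
    have : ((Z s y).card : ℝ) * ζ⁻¹ ≤ Fintype.card α := by
      rw [← div_eq_mul_inv, div_le_iff₀ hζ, mul_comm]
      exact hcard s y
    linarith
  have hmain := sum_prod_weights_le C W hW
    (fun s y y' h => by simp only [hWdef]; rw [hZ s y y' h]) hsum
  have hprod : ∀ y : ι → α, ∏ s ∈ C, W s y (y s) =
      (ζ⁻¹) ^ (C.filter fun s => y s ∈ Z s y).card := by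
    intro y
    simp only [hWdef]
    rw [Finset.prod_ite]
    simp
  simp only [hprod] at hmain
  have hpow : 0 < ζ ^ (θ * C.card) := Real.rpow_pos_of_pos hζ _
  have hlow : ∀ y ∈ Finset.univ.filter fun y : ι → α =>
      θ * C.card ≤ ((C.filter fun s => y s ∈ Z s y).card : ℝ),
      (ζ ^ (θ * C.card))⁻¹ ≤ (ζ⁻¹) ^ (C.filter fun s => y s ∈ Z s y).card := by
    intro y hy
    have hy' := (Finset.mem_filter.1 hy).2
    rw [inv_pow]
    refine inv_anti₀ (by positivity) ?_
    rw [← Real.rpow_natCast]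
    exact Real.rpow_le_rpow_of_exponent_ge hζ hζ1 hy'
  have h3 := (Finset.sum_le_sum hlow).trans
    ((Finset.sum_le_univ_sum_of_nonneg fun y => by positivity).trans hmain)
  rw [Finset.sum_const, nsmul_eq_mul, ← div_eq_mul_inv, div_le_iff₀ hpow] at h3
  calc _ ≤ _ := h3
    _ = _ := by ring

theorem exists_finset_short_lists (T : ℕ) :
    ∃ F : Finset (List Bool), (∀ l : List Bool, l.length < T → l ∈ F) ∧ F.card ≤ 2 ^ T := by
  refine ⟨(Finset.range T).biUnion fun n => Finset.univ.image
    (List.ofFn : (Fin n → Bool) → List Bool), ?_, ?_⟩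
  · intro l hl
    simp only [Finset.mem_biUnion, Finset.mem_range, Finset.mem_image, Finset.mem_univ, true_and]
    exact ⟨l.length, hl, l.get, List.ofFn_get l⟩
  · refine Finset.card_biUnion_le.trans ?_
    have : ∀ n ∈ Finset.range T, (Finset.univ.image
        (List.ofFn : (Fin n → Bool) → List Bool)).card ≤ 2 ^ n := by
      intro n _
      refine Finset.card_image_le.trans ?_
      simp
    refine (Finset.sum_le_sum this).trans ?_
    have := Nat.geomSum_eq (le_refl 2) T
    simp only [Nat.add_one_sub_one, Nat.div_one] at this
    rw [this]
    exact Nat.sub_le _ _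

/-- If, given the final state `st y` and the earlier symbols, each symbol of the chain `C` lies in a
set `Z` unless it lies in a set `Q` fixed before it was drawn, and these sets are small on average,
then few of the inputs `y` have a short final state. -/
theorem long_states_of_small_sets [DecidableEq α] [Nonempty α] (C : Finset ι) (hC : C.Nonempty)
    (st : (ι → α) → List Bool) (Q : ι → (ι → α) → Finset α)
    (Z : ι → List Bool → (ι → α) → Finset α)
    (hQ : ∀ s y y', (∀ i < s, y i = y' i) → Q s y = Q s y')
    (hZ : ∀ s z y y', (∀ i < s, y i = y' i) → Z s z y = Z s z y')
    (hmem : ∀ y, ∀ s ∈ C, y s ∈ Q s y ∨ y s ∈ Z s (st y) y)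
    (ζ θ η : ℝ) (hζ : 0 < ζ) (hζ1 : ζ ≤ 1) (hθ : 0 ≤ θ) (T : ℕ)
    (hT : (2 : ℝ) ^ T * 2 ^ C.card * ζ ^ (θ * C.card) ≤ η) :
    (Fintype.card (ι → α) : ℝ) * (1 - θ - η)
      - (∑ y, ∑ s ∈ C, ((Q s y).card : ℝ)) / (C.card * Fintype.card α)
      - (∑ y, ∑ s ∈ C, ((Z s (st y) y).card : ℝ)) / (C.card * (ζ * Fintype.card α))
      ≤ ∑ y, if T ≤ (st y).length then (1 : ℝ) else 0 := by
  have hu : (0 : ℝ) < Fintype.card α := by exact_mod_cast Fintype.card_pos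
  have hn : (0 : ℝ) < C.card := by exact_mod_cast hC.card_pos
  set u : ℝ := (Fintype.card α : ℝ)
  set n : ℝ := (C.card : ℝ)
  -- Sets of density above `ζ` are discarded, so that hits obey the bound for each fixed state; the
  -- discarded ones are charged by Markov's inequality in `hhit`.
  set Z' : List Bool → ι → (ι → α) → Finset α := fun z s y =>
    if ((Z s z y).card : ℝ) ≤ ζ * u then Z s z y else ∅ with hZ'def
  set hits : List Bool → (ι → α) → ℕ := fun z y => (C.filter fun s => y s ∈ Z' z s y).card
    with hhits
  obtain ⟨F, hF, hFc⟩ := exists_finset_short_lists T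
  have hbad : ∀ z, (((Finset.univ.filter fun y : ι → α => θ * n ≤ (hits z y : ℝ)).card : ℕ) : ℝ)
      ≤ 2 ^ C.card * ζ ^ (θ * n) * Fintype.card (ι → α) := by
    intro z
    refine card_many_hits_le C (Z' z) (fun s y y' h => ?_) ζ hζ hζ1 (fun s y => ?_) θ
    · simp only [hZ'def]
      rw [hZ s z y y' h]
    · simp only [hZ'def]
      split_ifs with h
      · exact h
      · simp only [Finset.card_empty, Nat.cast_zero]; positivity
  -- The short-state inputs with many hits: a union bound over the at most `2 ^ T` short states
  -- makes them rare.
  set B : Finset (ι → α) := Finset.univ.filter fun y =>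
    (st y).length < T ∧ θ * n ≤ (hits (st y) y : ℝ) with hB
  have hBcard : (B.card : ℝ) ≤ η * Fintype.card (ι → α) := by
    have hsub : B ⊆ F.biUnion fun z => Finset.univ.filter fun y : ι → α =>
        θ * n ≤ (hits z y : ℝ) := by
      intro y hy
      rw [hB, Finset.mem_filter] at hy
      simp only [Finset.mem_biUnion, Finset.mem_filter, Finset.mem_univ, true_and]
      exact ⟨st y, hF _ hy.2.1, hy.2.2⟩
    have h1 : (B.card : ℝ) ≤ ∑ z ∈ F, (((Finset.univ.filter fun y : ι → α =>
        θ * n ≤ (hits z y : ℝ)).card : ℕ) : ℝ) := by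
      exact_mod_cast (Finset.card_le_card hsub).trans Finset.card_biUnion_le
    have h2 := h1.trans (Finset.sum_le_sum fun z _ => hbad z)
    rw [Finset.sum_const, nsmul_eq_mul] at h2
    have h3 : (F.card : ℝ) ≤ 2 ^ T := by exact_mod_cast hFc
    have hp : 0 < ζ ^ (θ * n) := Real.rpow_pos_of_pos hζ _
    calc (B.card : ℝ) ≤ _ := h2
      _ ≤ 2 ^ T * (2 ^ C.card * ζ ^ (θ * n) * Fintype.card (ι → α)) :=
          mul_le_mul_of_nonneg_right h3 (by positivity)
      _ = (2 ^ T * 2 ^ C.card * ζ ^ (θ * n)) * Fintype.card (ι → α) := by ring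
      _ ≤ _ := mul_le_mul_of_nonneg_right hT (by positivity)
  have hpt : ∀ y : ι → α, (hits (st y) y : ℝ) / n - θ - (if y ∈ B then (1 : ℝ) else 0) ≤
      if T ≤ (st y).length then (1 : ℝ) else 0 := by
    intro y
    have hle : (hits (st y) y : ℝ) / n ≤ 1 := by
      rw [div_le_one hn]
      exact Nat.cast_le.2 (Finset.card_filter_le _ _)
    by_cases h1 : T ≤ (st y).length
    · rw [if_pos h1]
      split_ifs <;> linarith
    · rw [if_neg h1]
      by_cases h2 : θ * n ≤ (hits (st y) y : ℝ)
      · rw [if_pos (by rw [hB, Finset.mem_filter]; exact ⟨Finset.mem_univ _, not_le.1 h1, h2⟩)]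
        linarith
      · have : (hits (st y) y : ℝ) / n ≤ θ := by
          rw [div_le_iff₀ hn]; linarith
        split_ifs <;> linarith
  -- A position that is not a hit has its symbol in `Q` or a discarded set; in the second case the
  -- quotient by `ζ * u` exceeds 1.
  have hhit : ∀ y : ι → α, n - ∑ s ∈ C, (if y s ∈ Q s y then (1 : ℝ) else 0)
      - ∑ s ∈ C, ((Z s (st y) y).card : ℝ) / (ζ * u) ≤ hits (st y) y := by
    intro y
    have h1 : (hits (st y) y : ℝ) = ∑ s ∈ C, if y s ∈ Z' (st y) s y then (1 : ℝ) else 0 := by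
      simp [hhits]
    have h2 : n = ∑ s ∈ C, (1 : ℝ) := by simp [n]
    rw [h1, h2, ← Finset.sum_sub_distrib, ← Finset.sum_sub_distrib]
    refine Finset.sum_le_sum fun s hs => ?_
    have h0 : 0 ≤ ((Z s (st y) y).card : ℝ) / (ζ * u) := by positivity
    rcases hmem y s hs with h | h
    · rw [if_pos h]
      split_ifs <;> linarith
    · by_cases hsm : ((Z s (st y) y).card : ℝ) ≤ ζ * u
      · have : y s ∈ Z' (st y) s y := by simp only [hZ'def]; rw [if_pos hsm]; exact h
        rw [if_pos this]
        split_ifs <;> linarith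
      · have : 1 ≤ ((Z s (st y) y).card : ℝ) / (ζ * u) := by
          rw [le_div_iff₀ (by positivity)]; linarith
        split_ifs <;> linarith
  have hsumQ : ∑ y, ∑ s ∈ C, (if y s ∈ Q s y then (1 : ℝ) else 0) =
      (∑ y, ∑ s ∈ C, ((Q s y).card : ℝ)) / u := by
    rw [Finset.sum_comm, Finset.sum_comm (s := Finset.univ) (t := C), Finset.sum_div]
    exact Finset.sum_congr rfl fun s _ => sum_indicator_mem_eq s (Q s) (hQ s)
  calc _ = ∑ y : ι → α, ((n - ∑ s ∈ C, (if y s ∈ Q s y then (1 : ℝ) else 0)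
        - ∑ s ∈ C, ((Z s (st y) y).card : ℝ) / (ζ * u)) / n - θ) - η * Fintype.card (ι → α) := by
        simp only [sub_div, Finset.sum_sub_distrib, ← Finset.sum_div, hsumQ]
        simp only [Finset.sum_const, Finset.card_univ, nsmul_eq_mul]
        field_simp
        ring
    _ ≤ ∑ y : ι → α, ((hits (st y) y : ℝ) / n - θ) - B.card := by
        refine sub_le_sub (Finset.sum_le_sum fun y _ => ?_) hBcard
        exact sub_le_sub_right (div_le_div_of_nonneg_right (hhit y) hn.le) _
    _ = ∑ y : ι → α, ((hits (st y) y : ℝ) / n - θ - (if y ∈ B then (1 : ℝ) else 0)) := by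
        rw [Finset.sum_sub_distrib (s := Finset.univ)
          (f := fun y : ι → α => (hits (st y) y : ℝ) / n - θ)]
        simp
    _ ≤ _ := Finset.sum_le_sum fun y _ => hpt y

end Encoding

/-! ### Alternative histories leading to the same state -/

section StateMaps

variable {α : Type*} [DecidableEq α]

/-- A map from streams to states that factors through a transition system which may read the
number of processed items. -/
def IsStateMap (mem : List α → List Bool) : Prop :=
  ∀ l l' r : List α, l.length = l'.length → mem l = mem l' → mem (l ++ r) = mem (l' ++ r)

/-- `Reach mem τ N z c x`: some continuation of `τ` to length `N` leads to the state `z` and contains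
`x` at least `c` times. -/
def Reach (mem : List α → List Bool) (τ : List α) (N : ℕ) (z : List Bool) (c : ℕ) (x : α) : Prop :=
  ∃ ρ : List α, τ.length + ρ.length = N ∧ mem (τ ++ ρ) = z ∧ c ≤ ρ.count x

variable {mem : List α → List Bool}

theorem Reach.of_append (τ ρ : List α) (x : α) :
    Reach mem τ (τ ++ ρ).length (mem (τ ++ ρ)) (ρ.count x) x :=
  ⟨ρ, by simp, rfl, le_rfl⟩

theorem Reach.mono {τ : List α} {N : ℕ} {z : List Bool} {c c' : ℕ} {x : α}
    (h : Reach mem τ N z c x) (hc : c' ≤ c) : Reach mem τ N z c' x := by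
  obtain ⟨ρ, h1, h2, h3⟩ := h
  exact ⟨ρ, h1, h2, hc.trans h3⟩

/-- Histories can be spliced: after reaching the same state at the same length, the machine
continues alike from `σ` and from its substitute, so the occurrences in the two pieces add. -/
theorem Reach.trans (hm : IsStateMap mem) {τ σ : List α} {N : ℕ} {z : List Bool} {c d : ℕ} {x : α}
    (h1 : Reach mem τ σ.length (mem σ) c x) (h2 : Reach mem σ N z d x) :
    Reach mem τ N z (c + d) x := by
  obtain ⟨ρ, hl, hz, hc⟩ := h1
  obtain ⟨ρ', hl', hz', hd⟩ := h2
  refine ⟨ρ ++ ρ', ?_, ?_, ?_⟩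
  · rw [List.length_append]; omega
  · rw [← List.append_assoc, hm (τ ++ ρ) σ ρ' (by rw [List.length_append]; exact hl) hz, hz']
  · rw [List.count_append]; omega

theorem Reach.extend (hm : IsStateMap mem) {τ σ : List α} {c : ℕ} {x : α} (ρ : List α)
    (h : Reach mem τ σ.length (mem σ) c x) :
    Reach mem τ (σ ++ ρ).length (mem (σ ++ ρ)) c x :=
  (h.trans hm (Reach.of_append σ ρ x)).mono (Nat.le_add_right _ _)

variable [Fintype α]

open Classical in
/-- The keys that may have occurred at least `c` times between `τ` and the state `z` at length
`N`. -/
noncomputable def reachSet (mem : List α → List Bool) (τ : List α) (N : ℕ) (z : List Bool)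
    (c : ℕ) : Finset α :=
  Finset.univ.filter fun x => Reach mem τ N z c x

theorem mem_reachSet {τ : List α} {N : ℕ} {z : List Bool} {c : ℕ} {x : α} :
    x ∈ reachSet mem τ N z c ↔ Reach mem τ N z c x := by
  simp [reachSet]

theorem reachSet_subset_append (hm : IsStateMap mem) (τ σ ρ : List α) (c : ℕ) :
    reachSet mem τ σ.length (mem σ) c ⊆ reachSet mem τ (σ ++ ρ).length (mem (σ ++ ρ)) c := by
  intro x hx
  rw [mem_reachSet] at hx ⊢
  exact hx.extend hm ρ

end StateMaps

/-! ### Streams of repeated keys -/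

section WeightedStreams

variable {α : Type*}

/-- The stream that starts with `f` and continues with `w i` copies of `y i` for `i < s`. -/
def weightedStream {S : ℕ} (w : ℕ → ℕ) (f : List α) (y : Fin S → α) : ℕ → List α
  | 0 => f
  | s + 1 => weightedStream w f y s ++ if h : s < S then List.replicate (w s) (y ⟨s, h⟩) else []

variable {S : ℕ} (w : ℕ → ℕ) (f : List α)

theorem length_weightedStream (y : Fin S → α) {s : ℕ} (hs : s ≤ S) :
    (weightedStream w f y s).length = f.length + ∑ i ∈ Finset.range s, w i := by
  induction s with
  | zero => simp [weightedStream]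
  | succ s ih =>
    rw [weightedStream, List.length_append, ih (by omega), dif_pos (by omega : s < S),
      Finset.sum_range_succ, List.length_replicate, add_assoc]

theorem weightedStream_congr {y y' : Fin S → α} {s : ℕ} (h : ∀ i : Fin S, i.1 < s → y i = y' i) :
    weightedStream w f y s = weightedStream w f y' s := by
  induction s with
  | zero => rfl
  | succ s ih =>
    rw [weightedStream, weightedStream, ih fun i hi => h i (by omega)]
    congr 1
    split_ifs with hs
    · rw [h ⟨s, hs⟩ (by simp)]
    · rfl

theorem weightedStream_prefix (y : Fin S → α) {a b : ℕ} (hab : a ≤ b) :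
    ∃ ρ, weightedStream w f y b = weightedStream w f y a ++ ρ := by
  induction b, hab using Nat.le_induction with
  | base => exact ⟨[], by simp⟩
  | succ b _ ih =>
    obtain ⟨ρ, hρ⟩ := ih
    rw [weightedStream, hρ, List.append_assoc]
    exact ⟨_, rfl⟩

variable [DecidableEq α] {mem : List α → List Bool}

theorem reach_weightedStream_self (y : Fin S → α) {a b : ℕ} (s : Fin S) (ha : a ≤ s)
    (hb : (s : ℕ) < b) :
    Reach mem (weightedStream w f y a) (weightedStream w f y b).length
      (mem (weightedStream w f y b)) (w s) (y s) := by
  obtain ⟨ρ, hρ⟩ := weightedStream_prefix w f y ha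
  obtain ⟨ρ', hρ'⟩ := weightedStream_prefix w f y (Nat.succ_le_of_lt hb)
  have : weightedStream w f y b = weightedStream w f y a ++
      (ρ ++ List.replicate (w s) (y s) ++ ρ') := by
    rw [hρ', weightedStream, hρ, dif_pos s.2]
    simp [List.append_assoc]
  rw [this]
  refine (Reach.of_append _ _ _).mono ?_
  simp only [List.count_append, List.count_replicate_self]
  omega

variable [Fintype α]

theorem reachSet_weightedStream_mono (hm : IsStateMap mem) (y : Fin S → α) (τ : List α) (c : ℕ)
    {a b : ℕ} (hab : a ≤ b) :
    reachSet mem τ (weightedStream w f y a).length (mem (weightedStream w f y a)) c ⊆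
      reachSet mem τ (weightedStream w f y b).length (mem (weightedStream w f y b)) c := by
  obtain ⟨ρ, hρ⟩ := weightedStream_prefix w f y hab
  rw [hρ]
  exact reachSet_subset_append hm _ _ _ _

end WeightedStreams

/-! ### Streams cut into consecutive phases -/

section Phases

variable {α : Type*} [DecidableEq α] [Fintype α] {mem : List α → List Bool} {S : ℕ}

/-- The keys that may have occurred at least `k` times among the first `s` entries. -/
noncomputable def phaseSet (mem : List α → List Bool) (k : ℕ) (f : List α) (s : ℕ)
    (y : Fin S → α) : Finset α :=
  reachSet mem f (weightedStream (fun _ => k) f y s).length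
    (mem (weightedStream (fun _ => k) f y s)) k

theorem phaseSet_mono (hm : IsStateMap mem) (k : ℕ) (f : List α) {a b : ℕ} (hab : a ≤ b)
    (y : Fin S → α) : phaseSet mem k f a y ⊆ phaseSet mem k f b y :=
  reachSet_weightedStream_mono _ _ hm _ _ _ hab

theorem phaseSet_zero {k : ℕ} (hk : 0 < k) (f : List α) (y : Fin S → α) :
    phaseSet mem k f 0 y = ∅ := by
  rw [Finset.eq_empty_iff_forall_notMem]
  intro x hx
  rw [phaseSet, mem_reachSet] at hx
  obtain ⟨ρ, h1, -, h3⟩ := hx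
  have : ρ = [] := List.length_eq_zero_iff.1 (by simp only [weightedStream] at h1; omega)
  subst this
  simp at h3
  omega

/-- Within a phase all positions share the same two sets: the keys confused when the phase begins,
which its symbols cannot influence, and the keys that become confused during it. -/
theorem long_states_of_phase [Nonempty α] (hm : IsStateMap mem) (k : ℕ) (f : List α)
    {lo hi : ℕ} (hlo : lo < hi) (hhi : hi ≤ S) (ζ θ η : ℝ) (hζ : 0 < ζ) (hζ1 : ζ ≤ 1)
    (hθ : 0 ≤ θ) (T : ℕ)
    (hT : (2 : ℝ) ^ T * 2 ^ (hi - lo) * ζ ^ (θ * (hi - lo : ℕ)) ≤ η) :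
    (Fintype.card (Fin S → α) : ℝ) * (1 - θ - η)
      - (∑ y : Fin S → α, ((phaseSet mem k f lo y).card : ℝ)) / Fintype.card α
      - (∑ y : Fin S → α, (((phaseSet mem k f hi y).card : ℝ) - (phaseSet mem k f lo y).card)) /
        (ζ * Fintype.card α)
      ≤ ∑ y : Fin S → α,
        if T ≤ (mem (weightedStream (fun _ => k) f y hi)).length then (1 : ℝ) else 0 := by
  set C : Finset (Fin S) := Finset.univ.filter fun s => lo ≤ s.1 ∧ s.1 < hi with hCdef
  have hC : C.card = hi - lo := by
    rw [← Nat.card_Ico lo hi, ← Finset.card_map Fin.valEmbedding]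
    congr 1
    ext i
    simp only [hCdef, Finset.mem_map, Finset.mem_filter, Finset.mem_univ, true_and,
      Fin.valEmbedding_apply, Finset.mem_Ico]
    constructor
    · rintro ⟨s, hs, rfl⟩; exact hs
    · intro hi'; exact ⟨⟨i, by omega⟩, hi', rfl⟩
  have hn : (0 : ℝ) < C.card := by rw [hC]; exact_mod_cast Nat.sub_pos_of_lt hlo
  have key := long_states_of_small_sets C (Finset.card_pos.1 (by rw [hC]; omega))
    (fun y => mem (weightedStream (fun _ => k) f y hi))
    -- Before `lo` the sets default to `∅`: the chain has no such positions, but the dependence on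
    -- earlier symbols is required at every position.
    (fun s y => if lo ≤ s.1 then phaseSet mem k f lo y else ∅)
    -- The final length is written as a number independent of `y`, since this set may see later
    -- symbols only through the state `z`.
    (fun s z y => if lo ≤ s.1 then reachSet mem f (f.length + ∑ _i ∈ Finset.range hi, k) z k \
      phaseSet mem k f lo y else ∅)
    (fun s y y' h => by
      split_ifs with hs
      · rw [phaseSet, phaseSet, weightedStream_congr _ _ fun i hi =>
          h i (Fin.lt_def.2 (lt_of_lt_of_le hi hs))]
      · rfl)
    (fun s z y y' h => by
      split_ifs with hs
      · rw [phaseSet, phaseSet, weightedStream_congr _ _ fun i hi =>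
          h i (Fin.lt_def.2 (lt_of_lt_of_le hi hs))]
      · rfl)
    (fun y s hs => by
      have hs' := (Finset.mem_filter.1 hs).2
      rw [if_pos hs'.1, if_pos hs'.1, Finset.mem_sdiff]
      by_cases hmem : y s ∈ phaseSet mem k f lo y
      · exact Or.inl hmem
      · refine Or.inr ⟨?_, hmem⟩
        rw [mem_reachSet, ← length_weightedStream _ f y hhi]
        exact reach_weightedStream_self (fun _ => k) f y s (Nat.zero_le _) hs'.2)
    ζ θ η hζ hζ1 hθ T (by rw [hC]; exact hT)
  refine le_trans (le_of_eq ?_) key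
  have e1 : ∀ y : Fin S → α, ∑ s ∈ C, (((if lo ≤ s.1 then phaseSet mem k f lo y else ∅).card : ℕ) : ℝ)
      = C.card * (phaseSet mem k f lo y).card := by
    intro y
    rw [← nsmul_eq_mul, ← Finset.sum_const]
    exact Finset.sum_congr rfl fun s hs => by rw [if_pos (Finset.mem_filter.1 hs).2.1]
  have e2 : ∀ y : Fin S → α, ∑ s ∈ C, (((if lo ≤ s.1 then
      reachSet mem f (f.length + ∑ _i ∈ Finset.range hi, k)
        (mem (weightedStream (fun _ => k) f y hi)) k \
      phaseSet mem k f lo y else ∅).card : ℕ) : ℝ)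
      = C.card * ((phaseSet mem k f hi y).card - (phaseSet mem k f lo y).card) := by
    intro y
    rw [← nsmul_eq_mul, ← Finset.sum_const]
    refine Finset.sum_congr rfl fun s hs => ?_
    rw [if_pos (Finset.mem_filter.1 hs).2.1, ← length_weightedStream _ f y hhi]
    exact Finset.cast_card_sdiff (phaseSet_mono hm k f hlo.le y)
  simp only [e1, e2, ← Finset.mul_sum]
  rw [mul_div_mul_left _ _ hn.ne', mul_div_mul_left _ _ hn.ne']

theorem card_le_of_good_imp_notMem (N : ℕ) (V : Finset α) (σ : List α) (hσ : σ.length ≤ N)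
    (good : α → Prop) [DecidablePred good]
    (h : ∀ x, good x → x ∉ σ → x ∉ V) :
    (V.card : ℝ) ≤ Fintype.card α - (∑ x, if good x then (1 : ℝ) else 0) + N := by
  have h1 : V ⊆ (Finset.univ.filter fun x => ¬ good x) ∪ σ.toFinset := by
    intro x hx
    by_contra hcon
    simp only [Finset.mem_union, Finset.mem_filter, Finset.mem_univ, true_and, List.mem_toFinset,
      not_or, not_not] at hcon
    exact h x hcon.1 hcon.2 hx
  have h2 := (Finset.card_le_card h1).trans (Finset.card_union_le _ _)
  have h3 := (σ.toFinset_card_le).trans hσ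
  have h4 := Finset.card_filter_add_card_filter_not (s := (Finset.univ : Finset α)) good
  rw [Finset.card_univ] at h4
  have h5 : (∑ x, if good x then (1 : ℝ) else 0) = (Finset.univ.filter fun x => good x).card := by
    simp
  rw [h5, ← h4]
  push_cast
  have h6 : (V.card : ℝ) ≤ (Finset.univ.filter fun x => ¬ good x).card + N := by
    exact_mod_cast h2.trans (by omega)
  linarith

/-- Nothing is confused at the start, so `Q` is empty and the whole cost is the density of the final
phase set, which contains only badly estimated keys and keys of the stream. -/
theorem long_states_of_single_phase [Nonempty α] (hm : IsStateMap mem) {k : ℕ} (hk : 0 < k) (f : List α)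
    (hS : 0 < S) (good : (Fin S → α) → α → Prop) [∀ y, DecidablePred (good y)]
    (hgood : ∀ y x, good y x → x ∉ weightedStream (fun _ => k) f y S →
      x ∉ phaseSet mem k f S y) (ζ θ η : ℝ) (hζ : 0 < ζ) (hζ1 : ζ ≤ 1)
    (hθ : 0 ≤ θ) (T : ℕ) (hT : (2 : ℝ) ^ T * 2 ^ S * ζ ^ (θ * S) ≤ η) :
    (1 - θ - η) - (1 + (f.length + S * k : ℕ) / Fintype.card α) / ζ +
      (∑ y : Fin S → α, ∑ x, if good y x then (1 : ℝ) else 0) /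
        (Fintype.card (Fin S → α) * Fintype.card α) / ζ ≤
      (∑ y : Fin S → α, if T ≤ (mem (weightedStream (fun _ => k) f y S)).length then (1 : ℝ) else 0)
        / Fintype.card (Fin S → α) := by
  have hu : (0 : ℝ) < Fintype.card α := by exact_mod_cast Fintype.card_pos
  have hV : (0 : ℝ) < Fintype.card (Fin S → α) := by exact_mod_cast Fintype.card_pos
  have h := long_states_of_phase hm k f hS le_rfl ζ θ η hζ hζ1 hθ T (by simpa using hT)
  simp only [phaseSet_zero hk, Finset.card_empty, Nat.cast_zero, sub_zero, Finset.sum_const_zero,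
    zero_div] at h
  have h2 : ∑ y : Fin S → α, ((phaseSet mem k f S y).card : ℝ) ≤
      ∑ y : Fin S → α, ((Fintype.card α : ℝ) - (∑ x, if good y x then (1 : ℝ) else 0)
        + (f.length + S * k : ℕ)) := by
    refine Finset.sum_le_sum fun y _ => ?_
    refine card_le_of_good_imp_notMem _ _ (weightedStream (fun _ => k) f y S) ?_ (good y)
      (hgood y)
    rw [length_weightedStream _ _ _ le_rfl]
    simp
  rw [Finset.sum_add_distrib, Finset.sum_sub_distrib, Finset.sum_const, Finset.sum_const,
    Finset.card_univ, nsmul_eq_mul, nsmul_eq_mul] at h2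
  rw [le_div_iff₀ hV]
  refine le_trans (le_trans (le_of_eq ?_) (sub_le_sub_left
    (div_le_div_of_nonneg_right h2 (by positivity : 0 ≤ ζ * (Fintype.card α : ℝ))) _)) h
  field_simp
  ring

/-- Growth telescopes over the phases to at most one universe, which gives `1 / (h * ζ)` on average.
Each starting set lies in the final phase set, so the accuracy of the final estimates bounds all of
them. -/
theorem long_states_of_many_phases [Nonempty α] (hm : IsStateMap mem) {k : ℕ} (f : List α)
    {h : ℕ} (hh : 0 < h) (β : ℕ → ℕ) (hβ : StrictMono β) (hS : β h = S)
    (good : (Fin S → α) → α → Prop) [∀ y, DecidablePred (good y)]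
    (hgood : ∀ y x, good y x → x ∉ weightedStream (fun _ => k) f y S →
      x ∉ phaseSet mem k f S y) (ζ θ η : ℝ) (hζ : 0 < ζ) (hζ1 : ζ ≤ 1)
    (hθ : 0 ≤ θ) (T : ℕ → ℕ)
    (hT : ∀ g < h, (2 : ℝ) ^ T g * 2 ^ (β (g + 1) - β g) * ζ ^ (θ * (β (g + 1) - β g : ℕ)) ≤ η) :
    (1 - θ - η) - 1 / (h * ζ) - (1 + (f.length + S * k : ℕ) / Fintype.card α) +
      (∑ y : Fin S → α, ∑ x, if good y x then (1 : ℝ) else 0) /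
        (Fintype.card (Fin S → α) * Fintype.card α) ≤
      (∑ g ∈ Finset.range h, ∑ y : Fin S → α,
        if T g ≤ (mem (weightedStream (fun _ => k) f y (β (g + 1)))).length then (1 : ℝ) else 0)
        / (h * Fintype.card (Fin S → α)) := by
  have hu : (0 : ℝ) < Fintype.card α := by exact_mod_cast Fintype.card_pos
  have hV : (0 : ℝ) < Fintype.card (Fin S → α) := by exact_mod_cast Fintype.card_pos
  have hhR : (0 : ℝ) < h := by exact_mod_cast hh
  have hle : ∀ g, g ≤ h → β g ≤ S := fun g hg => hS ▸ hβ.monotone hg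
  have hsum := Finset.sum_le_sum fun g (hg : g ∈ Finset.range h) =>
    long_states_of_phase hm k f (hβ (Nat.lt_succ_self g)) (hle (g + 1) (Finset.mem_range.1 hg))
      ζ θ η hζ hζ1 hθ (T g) (hT g (Finset.mem_range.1 hg))
  set G : ℝ := ∑ y : Fin S → α, ∑ x, if good y x then (1 : ℝ) else 0 with hG
  have hend : ∑ y : Fin S → α, ((phaseSet mem k f S y).card : ℝ) ≤
      (Fintype.card (Fin S → α) : ℝ) * Fintype.card α - G
        + (Fintype.card (Fin S → α) : ℝ) * (f.length + S * k : ℕ) := by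
    have h2 : ∑ y : Fin S → α, ((phaseSet mem k f S y).card : ℝ) ≤
      ∑ y : Fin S → α, ((Fintype.card α : ℝ) - (∑ x, if good y x then (1 : ℝ) else 0)
        + (f.length + S * k : ℕ)) := by
      refine Finset.sum_le_sum fun y _ => ?_
      refine card_le_of_good_imp_notMem _ _ (weightedStream (fun _ => k) f y S) ?_ (good y)
        (hgood y)
      rw [length_weightedStream _ _ _ le_rfl]
      simp
    rwa [Finset.sum_add_distrib, Finset.sum_sub_distrib, Finset.sum_const, Finset.sum_const,
      Finset.card_univ, nsmul_eq_mul, nsmul_eq_mul] at h2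
  have hQ : ∀ g ∈ Finset.range h, ∑ y : Fin S → α, ((phaseSet mem k f (β g) y).card : ℝ) ≤
      (Fintype.card (Fin S → α) : ℝ) * Fintype.card α - G
        + (Fintype.card (Fin S → α) : ℝ) * (f.length + S * k : ℕ) := fun g hg =>
    (Finset.sum_le_sum fun y _ => Nat.cast_le.2 (Finset.card_le_card
      (phaseSet_mono hm k f (hle g (Finset.mem_range.1 hg).le) y))).trans hend
  have hQ' := Finset.sum_le_sum hQ
  rw [Finset.sum_const, Finset.card_range, nsmul_eq_mul] at hQ'
  have hZ : ∑ g ∈ Finset.range h, ∑ y : Fin S → α,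
      (((phaseSet mem k f (β (g + 1)) y).card : ℝ) - (phaseSet mem k f (β g) y).card) ≤
      Fintype.card (Fin S → α) * Fintype.card α := by
    rw [Finset.sum_comm]
    have : ∀ y ∈ (Finset.univ : Finset (Fin S → α)), ∑ g ∈ Finset.range h,
      (((phaseSet mem k f (β (g + 1)) y).card : ℝ) - (phaseSet mem k f (β g) y).card) ≤
        Fintype.card α := by
      intro y _
      rw [Finset.sum_range_sub fun g => ((phaseSet mem k f (β g) y).card : ℝ)]
      have h1 : ((phaseSet mem k f (β h) y).card : ℝ) ≤ Fintype.card α :=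
        Nat.cast_le.2 (Finset.card_le_univ _)
      have h2 : (0 : ℝ) ≤ ((phaseSet mem k f (β 0) y).card : ℝ) := Nat.cast_nonneg _
      linarith
    refine (Finset.sum_le_sum this).trans ?_
    rw [Finset.sum_const, Finset.card_univ, nsmul_eq_mul]
  rw [Finset.sum_sub_distrib, Finset.sum_sub_distrib, ← Finset.sum_div, ← Finset.sum_div,
    Finset.sum_const, Finset.card_range, nsmul_eq_mul] at hsum
  rw [le_div_iff₀ (by positivity)]
  refine le_trans (le_trans (le_of_eq ?_) (sub_le_sub (sub_le_sub_left
    (div_le_div_of_nonneg_right hQ' hu.le) _)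
    (div_le_div_of_nonneg_right hZ (by positivity : 0 ≤ ζ * (Fintype.card α : ℝ))))) hsum
  field_simp
  ring

end Phases

/-! ### Arithmetic of nested blocks -/

section Blocks

theorem sum_range_mul_eq_sum_sum {M : Type*} [AddCommMonoid M] (F : ℕ → M) (A L : ℕ) :
    ∑ t ∈ Finset.range (A * L), F t =
      ∑ q ∈ Finset.range A, ∑ r ∈ Finset.range L, F (q * L + r) := by
  induction A with
  | zero => simp
  | succ A ih => rw [Nat.succ_mul, Finset.sum_range_add, ih, Finset.sum_range_succ]

/-- The largest multiple of `b ^ ℓ` that is at most `t`. -/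
def blockStart (b ℓ t : ℕ) : ℕ := t / b ^ ℓ * b ^ ℓ

theorem blockStart_le (b ℓ t : ℕ) : blockStart b ℓ t ≤ t := Nat.div_mul_le_self _ _

theorem blockStart_anti {b : ℕ} {ℓ i : ℕ} (h : ℓ ≤ i) (t : ℕ) :
    blockStart b i t ≤ blockStart b ℓ t := by
  obtain ⟨j, rfl⟩ := Nat.exists_eq_add_of_le h
  unfold blockStart
  rw [pow_add, ← Nat.div_div_eq_div_mul, mul_comm (b ^ ℓ), ← mul_assoc]
  exact Nat.mul_le_mul_right _ (Nat.div_mul_le_self _ _)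

theorem blockStart_add {b : ℕ} (hb : 0 < b) (ℓ q r : ℕ) (hr : r < b ^ ℓ) :
    blockStart b ℓ (q * b ^ ℓ + r) = q * b ^ ℓ := by
  unfold blockStart
  rw [mul_comm q, Nat.mul_add_div (pow_pos hb ℓ), Nat.div_eq_of_lt hr, add_zero, mul_comm]

theorem blockStart_eq_of_div_eq {b : ℕ} {ℓ i : ℕ} (h : ℓ ≤ i) {t t' : ℕ}
    (ht : t / b ^ ℓ = t' / b ^ ℓ) : blockStart b i t = blockStart b i t' := by
  obtain ⟨j, rfl⟩ := Nat.exists_eq_add_of_le h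
  unfold blockStart
  rw [pow_add, ← Nat.div_div_eq_div_mul, ← Nat.div_div_eq_div_mul, ht]

end Blocks

/-! ### Confusion in a tree of nested time blocks -/

section Tree

variable {α : Type*} [DecidableEq α] {mem : List α → List Bool}

theorem Reach.chain (hm : IsStateMap mem) (P : ℕ → List α) (x : α) (c : ℕ → ℕ) (n : ℕ)
    (h : ∀ i < n, Reach mem (P i) (P (i + 1)).length (mem (P (i + 1))) (c i) x) :
    Reach mem (P 0) (P n).length (mem (P n)) (∑ i ∈ Finset.range n, c i) x := by
  induction n with
  | zero => exact ⟨[], by simp, by simp, by simp⟩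
  | succ n ih =>
    rw [Finset.sum_range_succ]
    exact (ih fun i hi => h i (by omega)).trans hm (h n (by omega))

variable [Fintype α]

/-- The keys that, given the state at time `v`, may have occurred `κ * b ^ ℓ` times since the start
of the block of size `b ^ ℓ` that contains the time `t`. -/
noncomputable def blockSet (mem : List α → List Bool) (P : ℕ → List α) (b κ ℓ t v : ℕ) : Finset α :=
  reachSet mem (P (blockStart b ℓ t)) (P v).length (mem (P v)) (κ * b ^ ℓ)

/-- The union of the block sets of heights from `ℓ` to `D - 1`. -/
noncomputable def blockUnion (mem : List α → List Bool) (P : ℕ → List α) (b κ D ℓ t v : ℕ) :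
    Finset α :=
  (Finset.Ico ℓ D).biUnion fun i => blockSet mem P b κ i t v

variable {P : ℕ → List α} {b D : ℕ}

theorem blockSet_mono (hm : IsStateMap mem) (hP : ∀ i j, i ≤ j → ∃ ρ, P j = P i ++ ρ) (κ ℓ t : ℕ)
    {v v' : ℕ} (h : v ≤ v') : blockSet mem P b κ ℓ t v ⊆ blockSet mem P b κ ℓ t v' := by
  obtain ⟨ρ, hρ⟩ := hP v v' h
  unfold blockSet
  rw [hρ]
  exact reachSet_subset_append hm _ _ _ _

theorem blockUnion_mono (hm : IsStateMap mem) (hP : ∀ i j, i ≤ j → ∃ ρ, P j = P i ++ ρ)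
    (κ ℓ t : ℕ) {v v' : ℕ} (h : v ≤ v') :
    blockUnion mem P b κ D ℓ t v ⊆ blockUnion mem P b κ D ℓ t v' :=
  Finset.biUnion_mono fun i _ => blockSet_mono hm hP κ i t h

theorem blockUnion_anti (κ t v : ℕ) {ℓ ℓ' : ℕ} (h : ℓ ≤ ℓ') :
    blockUnion mem P b κ D ℓ' t v ⊆ blockUnion mem P b κ D ℓ t v :=
  Finset.biUnion_subset_biUnion_of_subset_left _ (Finset.Ico_subset_Ico_left h)

theorem blockSet_subset_blockUnion (κ t v : ℕ) {ℓ : ℕ} (h : ℓ < D) :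
    blockSet mem P b κ ℓ t v ⊆ blockUnion mem P b κ D ℓ t v :=
  Finset.subset_biUnion_of_mem (fun i => blockSet mem P b κ i t v)
    (Finset.mem_Ico.2 ⟨le_rfl, h⟩)

theorem blockUnion_congr (κ v : ℕ) {ℓ t t' : ℕ} (h : t / b ^ ℓ = t' / b ^ ℓ) :
    blockUnion mem P b κ D ℓ t v = blockUnion mem P b κ D ℓ t' v := by
  unfold blockUnion
  refine Finset.biUnion_congr rfl fun i hi => ?_
  unfold blockSet
  rw [blockStart_eq_of_div_eq (Finset.mem_Ico.1 hi).1 h]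

open Classical in
/-- Many times at which `x` is confused inside some block can be exchanged, all at once, for many
occurrences of `x`: pass to the maximal blocks. -/
theorem reach_block (hm : IsStateMap mem) (hP : ∀ i j, i ≤ j → ∃ ρ, P j = P i ++ ρ)
    (hb : 0 < b) (κ : ℕ) (x : α) (ℓ : ℕ) :
    ∀ q, Reach mem (P (q * b ^ ℓ)) (P ((q + 1) * b ^ ℓ)).length (mem (P ((q + 1) * b ^ ℓ)))
      (κ * ∑ r ∈ Finset.range (b ^ ℓ),
        if ∃ i ≤ ℓ, x ∈ blockSet mem P b κ i (q * b ^ ℓ + r) (q * b ^ ℓ + r + 1) then 1 else 0)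
      x := by
  induction ℓ with
  | zero =>
    intro q
    by_cases h : x ∈ blockSet mem P b κ 0 (q * b ^ 0) ((q + 1) * b ^ 0)
    · have h' := mem_reachSet.1 h
      have : blockStart b 0 (q * b ^ 0) = q * b ^ 0 := by simp [blockStart]
      rw [this] at h'
      refine h'.mono (Nat.mul_le_mul_left _ ?_)
      refine (Finset.sum_le_card_nsmul _ _ 1 fun r _ => ?_).trans (by simp)
      split_ifs <;> simp
    · obtain ⟨ρ, hρ⟩ := hP (q * b ^ 0) ((q + 1) * b ^ 0) (Nat.mul_le_mul_right _ (Nat.le_succ q))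
      have h0 := (Reach.of_append (mem := mem) (P (q * b ^ 0)) ρ x).mono (Nat.zero_le _)
      rw [← hρ] at h0
      refine h0.mono (le_of_eq ?_)
      rw [Finset.sum_eq_zero, mul_zero]
      intro r hr
      have hr0 : r = 0 := by simpa using hr
      subst hr0
      rw [if_neg]
      rintro ⟨i, hi, hx⟩
      obtain rfl : i = 0 := by omega
      apply h
      simpa using hx
  | succ ℓ ih =>
    intro q
    have hq : (q + 1) * b ^ (ℓ + 1) = q * b ^ (ℓ + 1) + b ^ (ℓ + 1) := by ring
    by_cases h : x ∈ blockSet mem P b κ (ℓ + 1) (q * b ^ (ℓ + 1)) ((q + 1) * b ^ (ℓ + 1))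
    -- Confusion on the whole block already supplies `κ * b ^ (ℓ + 1)` occurrences, one `κ` for each
    -- time in it.
    · have h' := mem_reachSet.1 h
      have : blockStart b (ℓ + 1) (q * b ^ (ℓ + 1)) = q * b ^ (ℓ + 1) := by
        simpa using blockStart_add hb (ℓ + 1) q 0 (pow_pos hb _)
      rw [this] at h'
      refine h'.mono (Nat.mul_le_mul_left _ ?_)
      refine (Finset.sum_le_card_nsmul _ _ 1 fun r _ => ?_).trans (by simp)
      split_ifs <;> simp
    -- Confusion at height `ℓ + 1` at any time inside would persist to the end of the block. So only
    -- lower heights count, and the subblocks are chained.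
    · have hs : ∀ r ∈ Finset.range (b ^ (ℓ + 1)),
          (if ∃ i ≤ ℓ + 1, x ∈ blockSet mem P b κ i (q * b ^ (ℓ + 1) + r)
            (q * b ^ (ℓ + 1) + r + 1) then 1 else 0) =
          (if ∃ i ≤ ℓ, x ∈ blockSet mem P b κ i (q * b ^ (ℓ + 1) + r)
            (q * b ^ (ℓ + 1) + r + 1) then 1 else 0 : ℕ) := by
        intro r hr
        rw [Finset.mem_range] at hr
        congr 1
        refine propext ⟨?_, fun ⟨i, hi, hx⟩ => ⟨i, by omega, hx⟩⟩
        rintro ⟨i, hi, hx⟩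
        rcases Nat.lt_or_ge i (ℓ + 1) with h1 | h1
        · exact ⟨i, by omega, hx⟩
        · obtain rfl : i = ℓ + 1 := by omega
          refine absurd ?_ h
          have h2 := blockSet_mono (b := b) hm hP κ (ℓ + 1) (q * b ^ (ℓ + 1) + r)
            (v := q * b ^ (ℓ + 1) + r + 1) (v' := (q + 1) * b ^ (ℓ + 1)) (by omega) hx
          have h3 : blockStart b (ℓ + 1) (q * b ^ (ℓ + 1) + r) =
              blockStart b (ℓ + 1) (q * b ^ (ℓ + 1)) := by
            rw [blockStart_add hb _ _ _ hr]
            simpa using (blockStart_add hb (ℓ + 1) q 0 (pow_pos hb _)).symm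
          unfold blockSet at h2 ⊢
          rwa [h3] at h2
      rw [Finset.sum_congr rfl hs]
      have hpow : b ^ (ℓ + 1) = b * b ^ ℓ := by ring
      have hsplit : ∀ c, (q * b + c) * b ^ ℓ = q * b ^ (ℓ + 1) + c * b ^ ℓ := fun c => by ring
      have hc := Reach.chain hm (fun c => P ((q * b + c) * b ^ ℓ)) x
        (fun c => κ * ∑ r ∈ Finset.range (b ^ ℓ),
          if ∃ i ≤ ℓ, x ∈ blockSet mem P b κ i ((q * b + c) * b ^ ℓ + r)
            ((q * b + c) * b ^ ℓ + r + 1) then 1 else 0) b fun c _ => ih (q * b + c)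
      have e1 : (q * b + 0) * b ^ ℓ = q * b ^ (ℓ + 1) := by ring
      have e2 : (q * b + b) * b ^ ℓ = (q + 1) * b ^ (ℓ + 1) := by ring
      simp only [e1, e2] at hc
      refine hc.mono (le_of_eq ?_)
      rw [← Finset.mul_sum, hpow, sum_range_mul_eq_sum_sum]
      simp only [← hpow, hsplit, add_assoc]

open Classical in
theorem mul_card_confused_le (hm : IsStateMap mem) (hP : ∀ i j, i ≤ j → ∃ ρ, P j = P i ++ ρ)
    (hb : 0 < b) (hD : 0 < D) (κ : ℕ) (x : α) :
    Reach mem (P 0) (P (b ^ D)).length (mem (P (b ^ D)))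
      (κ * ∑ t ∈ Finset.range (b ^ D),
        if x ∈ blockUnion mem P b κ D 0 t (t + 1) then 1 else 0) x := by
  obtain ⟨d, rfl⟩ : ∃ d, D = d + 1 := ⟨D - 1, by omega⟩
  have hc := Reach.chain hm (fun c => P (c * b ^ d)) x _ b fun c _ => reach_block hm hP hb κ x d c
  have hpow : b ^ (d + 1) = b * b ^ d := by ring
  simp only [zero_mul] at hc
  rw [hpow, sum_range_mul_eq_sum_sum, Finset.mul_sum]
  refine hc.mono (le_of_eq (Finset.sum_congr rfl fun q _ => ?_))
  congr 1
  refine Finset.sum_congr rfl fun r _ => ?_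
  congr 1
  simp only [blockUnion, Finset.mem_biUnion, Finset.mem_Ico, Nat.zero_le, true_and,
    Nat.lt_succ_iff]

/-- The block union changes little within most of the subblocks. -/
theorem sum_growth_le (hm : IsStateMap mem) (hP : ∀ i j, i ≤ j → ∃ ρ, P j = P i ++ ρ)
    (hb : 0 < b) (κ : ℕ) {ℓ : ℕ} (hℓ : ℓ < D) :
    ∑ t ∈ Finset.range (b ^ D), (((blockUnion mem P b κ D (ℓ + 1) t (t + 1)).card : ℝ) -
      (blockUnion mem P b κ D (ℓ + 1) t (blockStart b ℓ t)).card) ≤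
      b ^ (D - 1) * Fintype.card α := by
  obtain ⟨d, rfl⟩ : ∃ d, D = d + (ℓ + 1) := ⟨D - (ℓ + 1), by omega⟩
  have hpow : b ^ (d + (ℓ + 1)) = b ^ d * (b * b ^ ℓ) := by ring
  rw [hpow, sum_range_mul_eq_sum_sum]
  have hin : ∀ p ∈ Finset.range (b ^ d), ∑ r ∈ Finset.range (b * b ^ ℓ),
      (((blockUnion mem P b κ (d + (ℓ + 1)) (ℓ + 1) (p * (b * b ^ ℓ) + r)
        (p * (b * b ^ ℓ) + r + 1)).card : ℝ) -
      (blockUnion mem P b κ (d + (ℓ + 1)) (ℓ + 1) (p * (b * b ^ ℓ) + r)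
        (blockStart b ℓ (p * (b * b ^ ℓ) + r))).card) ≤ b ^ ℓ * Fintype.card α := by
    intro p _
    -- Inside a block of size `b ^ (ℓ + 1)` the starting points at heights above `ℓ` are fixed, so
    -- the union only grows and its increments over the `b` subblocks telescope.
    set g : ℕ → ℝ := fun c => ((blockUnion mem P b κ (d + (ℓ + 1)) (ℓ + 1) (p * (b * b ^ ℓ))
      ((p * b + c) * b ^ ℓ)).card : ℝ) with hg
    rw [sum_range_mul_eq_sum_sum]
    have hterm : ∀ c ∈ Finset.range b, ∀ r ∈ Finset.range (b ^ ℓ),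
        (((blockUnion mem P b κ (d + (ℓ + 1)) (ℓ + 1) (p * (b * b ^ ℓ) + (c * b ^ ℓ + r))
          (p * (b * b ^ ℓ) + (c * b ^ ℓ + r) + 1)).card : ℝ) -
        (blockUnion mem P b κ (d + (ℓ + 1)) (ℓ + 1) (p * (b * b ^ ℓ) + (c * b ^ ℓ + r))
          (blockStart b ℓ (p * (b * b ^ ℓ) + (c * b ^ ℓ + r)))).card) ≤ g (c + 1) - g c := by
      intro c hc r hr
      rw [Finset.mem_range] at hc hr
      have hlt : c * b ^ ℓ + r < b * b ^ ℓ := by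
        calc c * b ^ ℓ + r < c * b ^ ℓ + b ^ ℓ := by omega
          _ = (c + 1) * b ^ ℓ := by ring
          _ ≤ b * b ^ ℓ := Nat.mul_le_mul_right _ hc
      have hdiv : (p * (b * b ^ ℓ) + (c * b ^ ℓ + r)) / b ^ (ℓ + 1) =
          (p * (b * b ^ ℓ)) / b ^ (ℓ + 1) := by
        have hb' : b ^ (ℓ + 1) = b * b ^ ℓ := by ring
        have hpos : 0 < b * b ^ ℓ := by positivity
        rw [hb', mul_comm p, Nat.mul_add_div hpos, Nat.div_eq_of_lt hlt,
          Nat.mul_div_cancel_left _ hpos, add_zero]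
      have e1 : p * (b * b ^ ℓ) + (c * b ^ ℓ + r) = (p * b + c) * b ^ ℓ + r := by ring
      have e2 : (p * b + (c + 1)) * b ^ ℓ = (p * b + c) * b ^ ℓ + b ^ ℓ := by ring
      rw [blockUnion_congr κ _ hdiv, blockUnion_congr κ (blockStart _ _ _) hdiv, e1,
        blockStart_add hb _ _ _ hr]
      refine sub_le_sub_right (Nat.cast_le.2 (Finset.card_le_card ?_)) _
      exact blockUnion_mono hm hP κ _ _ (by rw [e2]; omega)
    calc _ ≤ ∑ c ∈ Finset.range b, ∑ r ∈ Finset.range (b ^ ℓ), (g (c + 1) - g c) :=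
          Finset.sum_le_sum fun c hc => Finset.sum_le_sum fun r hr => hterm c hc r hr
      _ = b ^ ℓ * (g b - g 0) := by
          simp only [Finset.sum_const, Finset.card_range, nsmul_eq_mul]
          rw [← Finset.mul_sum, Finset.sum_range_sub]
          push_cast
          ring
      _ ≤ b ^ ℓ * Fintype.card α := by
          refine mul_le_mul_of_nonneg_left ?_ (by positivity)
          have h1 : g b ≤ Fintype.card α := Nat.cast_le.2 (Finset.card_le_univ _)
          have h2 : 0 ≤ g 0 := Nat.cast_nonneg _
          linarith
  refine (Finset.sum_le_sum hin).trans (le_of_eq ?_)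
  rw [Finset.sum_const, Finset.card_range, nsmul_eq_mul, ← mul_assoc]
  congr 1
  push_cast
  rw [← pow_add]
  congr 1

/-- The new keys split into those gained by admitting height `ℓ` at time `t + 1`, which telescope
over `ℓ` to one universe, and the growth of the higher union since the start of the subblock, which
costs a fraction `1 / b` per height. -/
theorem sum_card_new_le (hm : IsStateMap mem) (hP : ∀ i j, i ≤ j → ∃ ρ, P j = P i ++ ρ)
    (hb : 0 < b) (κ : ℕ) :
    ∑ t ∈ Finset.range (b ^ D), ∑ ℓ ∈ Finset.range D,
      ((blockSet mem P b κ ℓ t (t + 1) \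
        blockUnion mem P b κ D (ℓ + 1) t (blockStart b ℓ t)).card : ℝ) ≤
      (b ^ D + D * b ^ (D - 1)) * Fintype.card α := by
  have hpt : ∀ t ∈ Finset.range (b ^ D), ∑ ℓ ∈ Finset.range D,
      ((blockSet mem P b κ ℓ t (t + 1) \
        blockUnion mem P b κ D (ℓ + 1) t (blockStart b ℓ t)).card : ℝ) ≤
      Fintype.card α + ∑ ℓ ∈ Finset.range D,
        (((blockUnion mem P b κ D (ℓ + 1) t (t + 1)).card : ℝ) -
        (blockUnion mem P b κ D (ℓ + 1) t (blockStart b ℓ t)).card) := by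
    intro t _
    have h1 : ∀ ℓ ∈ Finset.range D, ((blockSet mem P b κ ℓ t (t + 1) \
        blockUnion mem P b κ D (ℓ + 1) t (blockStart b ℓ t)).card : ℝ) ≤
        (((blockUnion mem P b κ D ℓ t (t + 1)).card : ℝ) -
          (blockUnion mem P b κ D (ℓ + 1) t (t + 1)).card) +
        (((blockUnion mem P b κ D (ℓ + 1) t (t + 1)).card : ℝ) -
          (blockUnion mem P b κ D (ℓ + 1) t (blockStart b ℓ t)).card) := by
      intro ℓ hℓ
      rw [Finset.mem_range] at hℓ
      have hsub : blockUnion mem P b κ D (ℓ + 1) t (blockStart b ℓ t) ⊆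
          blockUnion mem P b κ D ℓ t (t + 1) :=
        (blockUnion_mono hm hP κ _ _ ((blockStart_le b ℓ t).trans (Nat.le_succ t))).trans
          (blockUnion_anti κ _ _ (Nat.le_succ ℓ))
      have h2 : ((blockSet mem P b κ ℓ t (t + 1) \
          blockUnion mem P b κ D (ℓ + 1) t (blockStart b ℓ t)).card : ℝ) ≤
          ((blockUnion mem P b κ D ℓ t (t + 1) \
            blockUnion mem P b κ D (ℓ + 1) t (blockStart b ℓ t)).card : ℝ) :=
        Nat.cast_le.2 (Finset.card_le_card (Finset.sdiff_subset_sdiff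
          (blockSet_subset_blockUnion κ t (t + 1) hℓ) (subset_refl _)))
      rw [Finset.cast_card_sdiff hsub] at h2
      linarith
    refine (Finset.sum_le_sum h1).trans ?_
    rw [Finset.sum_add_distrib]
    refine add_le_add_left ?_ _
    rw [Finset.sum_range_sub' fun ℓ => ((blockUnion mem P b κ D ℓ t (t + 1)).card : ℝ)]
    have h1 : ((blockUnion mem P b κ D 0 t (t + 1)).card : ℝ) ≤ Fintype.card α :=
      Nat.cast_le.2 (Finset.card_le_univ _)
    have h2 : (0 : ℝ) ≤ ((blockUnion mem P b κ D D t (t + 1)).card : ℝ) := Nat.cast_nonneg _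
    linarith
  refine (Finset.sum_le_sum hpt).trans ?_
  rw [Finset.sum_add_distrib, Finset.sum_comm (s := Finset.range (b ^ D)), Finset.sum_const,
    Finset.card_range, nsmul_eq_mul, add_mul]
  push_cast
  refine add_le_add_right ?_ _
  refine (Finset.sum_le_sum fun ℓ hℓ => sum_growth_le hm hP hb κ (Finset.mem_range.1 hℓ)).trans ?_
  rw [Finset.sum_const, Finset.card_range, nsmul_eq_mul, mul_assoc]

/-- Double counting of keys and times: a good key outside the stream is confused at no more than `E
/ κ` times, since each such time contributes `κ` possible occurrences; every other key is charged at
all times. -/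
theorem sum_card_blockUnion_le (hm : IsStateMap mem) (hP : ∀ i j, i ≤ j → ∃ ρ, P j = P i ++ ρ)
    (hb : 0 < b) (hD : 0 < D) {κ : ℕ} (hκ : 0 < κ) (E : ℝ) (hE : 0 ≤ E)
    (good : α → Prop) [DecidablePred good]
    (h : ∀ x c, good x → x ∉ P (b ^ D) →
      Reach mem (P 0) (P (b ^ D)).length (mem (P (b ^ D))) c x → (c : ℝ) ≤ E) :
    ∑ t ∈ Finset.range (b ^ D), ((blockUnion mem P b κ D 0 t (t + 1)).card : ℝ) ≤
      Fintype.card α * (E / κ) + b ^ D * (Fintype.card α - (∑ x, if good x then (1 : ℝ) else 0)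
        + (P (b ^ D)).length) := by
  classical
  have hκ' : (0 : ℝ) < κ := by exact_mod_cast hκ
  set V : Finset α := Finset.univ.filter fun x => ¬ (good x ∧ x ∉ P (b ^ D)) with hV
  have hVc : (V.card : ℝ) ≤ Fintype.card α - (∑ x, if good x then (1 : ℝ) else 0)
      + (P (b ^ D)).length := by
    refine card_le_of_good_imp_notMem _ V (P (b ^ D)) le_rfl good fun x hx hx' hxV => ?_
    exact (Finset.mem_filter.1 hxV).2 ⟨hx, hx'⟩
  have hcount : ∀ t ∈ Finset.range (b ^ D), ((blockUnion mem P b κ D 0 t (t + 1)).card : ℝ) =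
      ∑ x, if x ∈ blockUnion mem P b κ D 0 t (t + 1) then (1 : ℝ) else 0 := by
    intro t _
    simp
  rw [Finset.sum_congr rfl hcount, Finset.sum_comm]
  have hx : ∀ x ∈ (Finset.univ : Finset α), ∑ t ∈ Finset.range (b ^ D),
      (if x ∈ blockUnion mem P b κ D 0 t (t + 1) then (1 : ℝ) else 0) ≤
      E / κ + b ^ D * (if x ∈ V then 1 else 0) := by
    intro x _
    by_cases hxV : x ∈ V
    · rw [if_pos hxV, mul_one]
      have : ∑ t ∈ Finset.range (b ^ D),
          (if x ∈ blockUnion mem P b κ D 0 t (t + 1) then (1 : ℝ) else 0) ≤ b ^ D := by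
        refine (Finset.sum_le_card_nsmul _ _ 1 fun r _ => ?_).trans (by simp)
        split_ifs <;> norm_num
      have h0 : 0 ≤ E / κ := by positivity
      linarith
    · have hxg : good x ∧ x ∉ P (b ^ D) := by
        by_contra hcon
        exact hxV (Finset.mem_filter.2 ⟨Finset.mem_univ _, hcon⟩)
      have h1 := h x _ hxg.1 hxg.2 (mul_card_confused_le hm hP hb hD κ x)
      rw [if_neg hxV, mul_zero, add_zero, le_div_iff₀ hκ', mul_comm]
      push_cast at h1
      exact h1
  refine (Finset.sum_le_sum hx).trans ?_
  rw [Finset.sum_add_distrib, Finset.sum_const, Finset.card_univ, nsmul_eq_mul, ← Finset.mul_sum]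
  have : ∑ x, (if x ∈ V then (1 : ℝ) else 0) = V.card := by simp
  rw [this]
  exact add_le_add_right (mul_le_mul_of_nonneg_left hVc (by positivity)) _

end Tree

/-! ### The random stream carried by the tree -/

section TreeStream

/-- The weights of the tree stream: time `t` consists of `D * m` slots, `m` for each height `ℓ < D`;
those of height `ℓ` are used only when `b ^ ℓ` divides `t`, and have the weight `κ * b ^ ℓ`. -/
def treeWeight (b D m κ s : ℕ) : ℕ :=
  if b ^ (s % (D * m) / m) ∣ s / (D * m) then κ * b ^ (s % (D * m) / m) else 0

/-- The slots of the blocks that contain the time `t`. -/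
def treeChain {b D m t : ℕ} (ht : t < b ^ D) : Fin (D * m) ↪ Fin (b ^ D * (D * m)) where
  toFun r := ⟨blockStart b (r / m) t * (D * m) + r, by
    calc blockStart b (r / m) t * (D * m) + r < blockStart b (r / m) t * (D * m) + D * m :=
          Nat.add_lt_add_left r.2 _
      _ = (blockStart b (r / m) t + 1) * (D * m) := by ring
      _ ≤ b ^ D * (D * m) :=
          Nat.mul_le_mul_right _ (lt_of_le_of_lt (blockStart_le _ _ _) ht)⟩
  inj' := by
    intro r r' h
    have h1 := congrArg (fun i : Fin (b ^ D * (D * m)) => i.1 % (D * m)) h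
    simp only [Nat.mul_add_mod_of_lt r.2, Nat.mul_add_mod_of_lt r'.2] at h1
    exact Fin.ext h1

theorem treeChain_val {b D m t : ℕ} (ht : t < b ^ D) (r : Fin (D * m)) :
    (treeChain ht r : ℕ) = blockStart b (r / m) t * (D * m) + r := rfl

theorem treeChain_div {b D m t : ℕ} (ht : t < b ^ D) (r : Fin (D * m)) :
    (treeChain ht r : ℕ) / (D * m) = blockStart b (r / m) t := by
  have hpos : 0 < D * m := r.pos
  rw [treeChain_val, mul_comm _ (D * m), Nat.mul_add_div hpos, Nat.div_eq_of_lt r.2, add_zero]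

theorem treeChain_mod {b D m t : ℕ} (ht : t < b ^ D) (r : Fin (D * m)) :
    (treeChain ht r : ℕ) % (D * m) = r := by
  rw [treeChain_val, Nat.mul_add_mod_of_lt r.2]

theorem treeWeight_treeChain {b D m t : ℕ} (κ : ℕ) (ht : t < b ^ D) (r : Fin (D * m)) :
    treeWeight b D m κ (treeChain ht r) = κ * b ^ ((r : ℕ) / m) := by
  unfold treeWeight
  rw [treeChain_div, treeChain_mod, if_pos]
  exact Dvd.intro_left _ rfl

theorem sum_range_dvd {b : ℕ} (hb : 0 < b) (d ℓ : ℕ) :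
    ∑ t ∈ Finset.range (b ^ (d + ℓ)), (if b ^ ℓ ∣ t then 1 else 0) = b ^ d := by
  rw [pow_add, sum_range_mul_eq_sum_sum]
  have : ∀ q ∈ Finset.range (b ^ d),
      ∑ r ∈ Finset.range (b ^ ℓ), (if b ^ ℓ ∣ q * b ^ ℓ + r then 1 else 0) = 1 := by
    intro q _
    rw [Finset.sum_eq_single 0]
    · simp
    · intro r hr hr0
      rw [if_neg]
      rw [← Nat.dvd_add_iff_right (Dvd.intro_left q rfl)]
      exact fun h => hr0 (Nat.eq_zero_of_dvd_of_lt h (Finset.mem_range.1 hr))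
    · intro h
      exact absurd (Finset.mem_range.2 (pow_pos hb ℓ)) h
  rw [Finset.sum_congr rfl this]
  simp

/-- All heights weigh the same: height `ℓ` has `b ^ (D - ℓ)` blocks with `m` slots of weight `κ * b
^ ℓ`. -/
theorem sum_treeWeight {b m : ℕ} (hb : 0 < b) (hm : 0 < m) (D κ : ℕ) :
    ∑ s ∈ Finset.range (b ^ D * (D * m)), treeWeight b D m κ s = D * m * (κ * b ^ D) := by
  rw [sum_range_mul_eq_sum_sum]
  have h1 : ∀ q ∈ Finset.range (b ^ D), ∑ r ∈ Finset.range (D * m),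
      treeWeight b D m κ (q * (D * m) + r) =
      ∑ ℓ ∈ Finset.range D, m * (κ * b ^ ℓ * (if b ^ ℓ ∣ q then 1 else 0)) := by
    intro q _
    rw [sum_range_mul_eq_sum_sum]
    refine Finset.sum_congr rfl fun ℓ hℓ => ?_
    rw [← Finset.card_range m, ← smul_eq_mul (Finset.range m).card, ← Finset.sum_const]
    refine Finset.sum_congr (by simp) fun i hi => ?_
    rw [Finset.card_range, Finset.mem_range] at *
    have hlt : ℓ * m + i < D * m := by
      calc ℓ * m + i < ℓ * m + m := by omega
        _ = (ℓ + 1) * m := by ring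
        _ ≤ D * m := Nat.mul_le_mul_right _ hℓ
    have hpos : 0 < D * m := by omega
    unfold treeWeight
    rw [Nat.mul_add_mod_of_lt hlt, mul_comm q, Nat.mul_add_div hpos, Nat.div_eq_of_lt hlt,
      add_zero, mul_comm ℓ, Nat.mul_add_div hm, Nat.div_eq_of_lt hi, add_zero]
    split_ifs <;> simp
  rw [Finset.sum_congr rfl h1, Finset.sum_comm]
  have h2 : ∀ ℓ ∈ Finset.range D, ∑ q ∈ Finset.range (b ^ D),
      m * (κ * b ^ ℓ * (if b ^ ℓ ∣ q then 1 else 0)) = m * (κ * b ^ D) := by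
    intro ℓ hℓ
    obtain ⟨d, rfl⟩ : ∃ d, D = d + ℓ := ⟨D - ℓ, by have := Finset.mem_range.1 hℓ; omega⟩
    rw [← Finset.mul_sum, ← Finset.mul_sum, sum_range_dvd hb, pow_add]
    ring
  rw [Finset.sum_congr rfl h2, Finset.sum_const, Finset.card_range, smul_eq_mul]
  ring

variable {α : Type*} [DecidableEq α] [Fintype α] [Nonempty α] {mem : List α → List Bool}

/-- The chain for time `t` consists of the keys inserted at the starts of the blocks containing `t`.
For a block of height `ℓ`, the confused keys of all greater heights are already determined when its
slots are filled and serve as `Q`; `Z` holds the keys that height `ℓ` adds by time `t + 1`. -/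
theorem long_states_of_leaf (hmem : IsStateMap mem) {b D m : ℕ} (hD : 0 < D)
    (hm : 0 < m) (κ : ℕ) (f : List α) {t : ℕ} (ht : t < b ^ D) (ζ θ η : ℝ) (hζ : 0 < ζ)
    (hζ1 : ζ ≤ 1) (hθ : 0 ≤ θ) (T : ℕ)
    (hT : (2 : ℝ) ^ T * 2 ^ (D * m) * ζ ^ (θ * (D * m : ℕ)) ≤ η)
    (P : (Fin (b ^ D * (D * m)) → α) → ℕ → List α)
    (hPdef : P = fun y t => weightedStream (treeWeight b D m κ) f y (t * (D * m))) :
    (Fintype.card (Fin (b ^ D * (D * m)) → α) : ℝ) * (1 - θ - η)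
      - (∑ y, ((blockUnion mem (P y) b κ D 0 t (t + 1)).card : ℝ)) / Fintype.card α
      - (∑ y, ∑ ℓ ∈ Finset.range D, ((blockSet mem (P y) b κ ℓ t (t + 1) \
        blockUnion mem (P y) b κ D (ℓ + 1) t (blockStart b ℓ t)).card : ℝ)) /
        (D * (ζ * Fintype.card α))
      ≤ ∑ y, if T ≤ (mem (P y (t + 1))).length then (1 : ℝ) else 0 := by
  have hu : (0 : ℝ) < Fintype.card α := by exact_mod_cast Fintype.card_pos
  have hDR : (0 : ℝ) < D := by exact_mod_cast hD
  have hmR : (0 : ℝ) < m := by exact_mod_cast hm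
  have hpos : 0 < D * m := Nat.mul_pos hD hm
  have hP : ∀ y i j, i ≤ j → ∃ ρ, P y j = P y i ++ ρ := by
    subst hPdef
    exact fun y i j hij => weightedStream_prefix _ _ _ (Nat.mul_le_mul_right _ hij)
  have hPcongr : ∀ (y y' : Fin (b ^ D * (D * m)) → α) (s : Fin (b ^ D * (D * m))) (i : ℕ),
      (∀ j < s, y j = y' j) → i * (D * m) ≤ s.1 → P y i = P y' i := by
    intro y y' s i h hi
    subst hPdef
    exact weightedStream_congr _ _ fun j hj => h j (Fin.lt_def.2 (lt_of_lt_of_le hj hi))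
  set N : ℕ := f.length + ∑ s ∈ Finset.range ((t + 1) * (D * m)), treeWeight b D m κ s with hN
  have hlen : ∀ y, (P y (t + 1)).length = N := by
    intro y
    subst hPdef
    exact length_weightedStream _ _ _ (Nat.mul_le_mul_right _ ht)
  -- Slots preceding the relevant block start get `∅`; none is in the chain, but `Q` must depend on
  -- earlier symbols only at every slot.
  set Q : Fin (b ^ D * (D * m)) → (Fin (b ^ D * (D * m)) → α) → Finset α := fun s y =>
    if blockStart b (s.1 % (D * m) / m) t * (D * m) ≤ s.1 then
      blockUnion mem (P y) b κ D (s.1 % (D * m) / m + 1) t (blockStart b (s.1 % (D * m) / m) t)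
    else ∅ with hQdef
  set Z : Fin (b ^ D * (D * m)) → List Bool → (Fin (b ^ D * (D * m)) → α) → Finset α := fun s z y =>
    if blockStart b (s.1 % (D * m) / m) t * (D * m) ≤ s.1 then
      reachSet mem (P y (blockStart b (s.1 % (D * m) / m) t)) N z
        (κ * b ^ (s.1 % (D * m) / m)) \
      blockUnion mem (P y) b κ D (s.1 % (D * m) / m + 1) t (blockStart b (s.1 % (D * m) / m) t)
    else ∅ with hZdef
  have hUcongr : ∀ (y y' : Fin (b ^ D * (D * m)) → α) (s : Fin (b ^ D * (D * m))) (ℓ : ℕ),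
      (∀ j < s, y j = y' j) → blockStart b ℓ t * (D * m) ≤ s.1 →
      blockUnion mem (P y) b κ D (ℓ + 1) t (blockStart b ℓ t) =
      blockUnion mem (P y') b κ D (ℓ + 1) t (blockStart b ℓ t) := by
    intro y y' s ℓ h hs
    unfold blockUnion
    refine Finset.biUnion_congr rfl fun i hi => ?_
    have hi' := (Finset.mem_Ico.1 hi).1
    unfold blockSet
    rw [hPcongr y y' s _ h hs, hPcongr y y' s (blockStart b i t) h
      ((Nat.mul_le_mul_right _ (blockStart_anti (by omega) t)).trans hs)]
  have hQc : ∀ y (r : Fin (D * m)), Q (treeChain ht r) y =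
      blockUnion mem (P y) b κ D ((r : ℕ) / m + 1) t (blockStart b ((r : ℕ) / m) t) := by
    intro y r
    simp only [hQdef]
    rw [treeChain_mod, if_pos (by rw [treeChain_val]; exact Nat.le_add_right _ _)]
  have hZc : ∀ y (r : Fin (D * m)), Z (treeChain ht r) (mem (P y (t + 1))) y =
      blockSet mem (P y) b κ ((r : ℕ) / m) t (t + 1) \
      blockUnion mem (P y) b κ D ((r : ℕ) / m + 1) t (blockStart b ((r : ℕ) / m) t) := by
    intro y r
    simp only [hZdef]
    rw [treeChain_mod, if_pos (by rw [treeChain_val]; exact Nat.le_add_right _ _), ← hlen y]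
    rfl
  set C : Finset (Fin (b ^ D * (D * m))) := Finset.univ.map (treeChain ht) with hC
  have hCcard : C.card = D * m := by simp [hC]
  have key := long_states_of_small_sets C (Finset.card_pos.1 (by rw [hCcard]; exact hpos))
    (fun y => mem (P y (t + 1))) Q Z
    (fun s y y' h => by
      simp only [hQdef]
      split_ifs with hs
      · exact hUcongr y y' s _ h hs
      · rfl)
    (fun s z y y' h => by
      simp only [hZdef]
      split_ifs with hs
      · rw [hUcongr y y' s _ h hs, hPcongr y y' s _ h hs]
      · rfl)
    (fun y s hs => by
      obtain ⟨r, -, rfl⟩ := Finset.mem_map.1 hs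
      rw [hQc, hZc, Finset.mem_sdiff]
      refine or_iff_not_imp_left.2 fun hnot => ⟨?_, hnot⟩
      unfold blockSet
      rw [mem_reachSet]
      have h1 : blockStart b ((r : ℕ) / m) t * (D * m) ≤ (treeChain ht r : ℕ) := by
        rw [treeChain_val]
        exact Nat.le_add_right _ _
      have h2 : (treeChain ht r : ℕ) < (t + 1) * (D * m) := by
        have h3 := treeChain_val ht r
        have h4 := Nat.mul_le_mul_right (D * m) (blockStart_le b ((r : ℕ) / m) t)
        have h5 : (t + 1) * (D * m) = t * (D * m) + D * m := by ring
        have h6 := r.2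
        omega
      have h7 := reach_weightedStream_self (mem := mem) (treeWeight b D m κ) f y
        (treeChain ht r) h1 h2
      rw [treeWeight_treeChain] at h7
      subst hPdef
      exact h7)
    ζ θ η hζ hζ1 hθ T (by rw [hCcard]; exact hT)
  have hsumQ : ∀ y, ∑ s ∈ C, ((Q s y).card : ℝ) ≤
      (D * m : ℕ) * ((blockUnion mem (P y) b κ D 0 t (t + 1)).card : ℝ) := by
    intro y
    rw [hC, Finset.sum_map]
    simp only [hQc]
    refine (Finset.sum_le_card_nsmul _ _
      ((blockUnion mem (P y) b κ D 0 t (t + 1)).card : ℝ) fun r _ => ?_).trans (le_of_eq ?_)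
    · refine Nat.cast_le.2 (Finset.card_le_card ?_)
      exact (blockUnion_mono hmem (hP y) κ _ _
        ((blockStart_le b _ t).trans (Nat.le_succ t))).trans (blockUnion_anti κ _ _ (Nat.zero_le _))
    · simp
  have hsumZ : ∀ y, ∑ s ∈ C, ((Z s (mem (P y (t + 1))) y).card : ℝ) =
      m * ∑ ℓ ∈ Finset.range D, ((blockSet mem (P y) b κ ℓ t (t + 1) \
        blockUnion mem (P y) b κ D (ℓ + 1) t (blockStart b ℓ t)).card : ℝ) := by
    intro y
    rw [hC, Finset.sum_map]
    simp only [hZc]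
    rw [Fin.sum_univ_eq_sum_range (fun r => ((blockSet mem (P y) b κ (r / m) t (t + 1) \
      blockUnion mem (P y) b κ D (r / m + 1) t (blockStart b (r / m) t)).card : ℝ)) (D * m),
      sum_range_mul_eq_sum_sum, Finset.mul_sum]
    refine Finset.sum_congr rfl fun ℓ _ => ?_
    rw [← Finset.card_range m, ← nsmul_eq_mul, ← Finset.sum_const, Finset.card_range]
    refine Finset.sum_congr rfl fun i hi => ?_
    rw [mul_comm ℓ, Nat.mul_add_div hm, Nat.div_eq_of_lt (Finset.mem_range.1 hi), add_zero]
  simp only [hsumZ, hCcard, ← Finset.mul_sum] at key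
  have h1 := (Finset.sum_le_sum fun y (_ : y ∈ Finset.univ) => hsumQ y)
  rw [← Finset.mul_sum] at h1
  have h2 := div_le_div_of_nonneg_right h1
    (by positivity : (0 : ℝ) ≤ ((D * m : ℕ) : ℝ) * Fintype.card α)
  have hnR : ((D * m : ℕ) : ℝ) ≠ 0 := Nat.cast_ne_zero.2 hpos.ne'
  rw [mul_div_mul_left _ _ hnR] at h2
  have h3 : ∀ X : ℝ, m * X / ((D * m : ℕ) * (ζ * Fintype.card α)) =
      X / (D * (ζ * Fintype.card α)) := by
    intro X
    rw [Nat.cast_mul, mul_comm (D : ℝ), mul_assoc, mul_div_mul_left _ _ hmR.ne']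
  rw [h3] at key
  linarith

/-- Average of the leaf bounds over all `b ^ D` times: the individual sets may be large at some
times, and only their sums over time are controlled. -/
theorem long_states_of_tree (hmem : IsStateMap mem) {b D m κ : ℕ} (hb : 0 < b) (hD : 0 < D)
    (hm : 0 < m) (hκ : 0 < κ) (f : List α) (ζ θ η : ℝ) (hζ : 0 < ζ)
    (hζ1 : ζ ≤ 1) (hθ : 0 ≤ θ) (T : ℕ)
    (hT : (2 : ℝ) ^ T * 2 ^ (D * m) * ζ ^ (θ * (D * m : ℕ)) ≤ η) (E : ℝ) (hE : 0 ≤ E)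
    (good : (Fin (b ^ D * (D * m)) → α) → α → Prop) [∀ y, DecidablePred (good y)]
    (hgood : ∀ y x c, good y x →
      x ∉ weightedStream (treeWeight b D m κ) f y (b ^ D * (D * m)) →
      Reach mem f (weightedStream (treeWeight b D m κ) f y (b ^ D * (D * m))).length
        (mem (weightedStream (treeWeight b D m κ) f y (b ^ D * (D * m)))) c x → (c : ℝ) ≤ E) :
    (1 - θ - η) - (1 + D / b) / (D * ζ)
      - (E / (κ * b ^ D) + 1 + (f.length + D * m * (κ * b ^ D) : ℕ) / Fintype.card α) +
      (∑ y : Fin (b ^ D * (D * m)) → α, ∑ x, if good y x then (1 : ℝ) else 0) /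
        (Fintype.card (Fin (b ^ D * (D * m)) → α) * Fintype.card α) ≤
      (∑ t ∈ Finset.range (b ^ D), ∑ y : Fin (b ^ D * (D * m)) → α,
        if T ≤ (mem (weightedStream (treeWeight b D m κ) f y ((t + 1) * (D * m)))).length
          then (1 : ℝ) else 0)
        / (b ^ D * Fintype.card (Fin (b ^ D * (D * m)) → α)) := by
  have hu : (0 : ℝ) < Fintype.card α := by exact_mod_cast Fintype.card_pos
  have hV : (0 : ℝ) < Fintype.card (Fin (b ^ D * (D * m)) → α) := by
    exact_mod_cast Fintype.card_pos
  have hDR : (0 : ℝ) < D := by exact_mod_cast hD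
  have hbR : (0 : ℝ) < b := by exact_mod_cast hb
  have hκR : (0 : ℝ) < κ := by exact_mod_cast hκ
  obtain ⟨P, hPdef⟩ : ∃ P : (Fin (b ^ D * (D * m)) → α) → ℕ → List α,
    P = fun y t => weightedStream (treeWeight b D m κ) f y (t * (D * m)) := ⟨_, rfl⟩
  have hP : ∀ y i j, i ≤ j → ∃ ρ, P y j = P y i ++ ρ := by
    subst hPdef
    exact fun y i j hij => weightedStream_prefix _ _ _ (Nat.mul_le_mul_right _ hij)
  have hend : ∀ y, P y (b ^ D) = weightedStream (treeWeight b D m κ) f y (b ^ D * (D * m)) := by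
    subst hPdef; exact fun y => rfl
  have hstart : ∀ y, P y 0 = f := by
    subst hPdef
    intro y
    simp [weightedStream]
  have hsum := Finset.sum_le_sum fun t (ht : t ∈ Finset.range (b ^ D)) =>
    long_states_of_leaf hmem hD hm κ f (Finset.mem_range.1 ht) ζ θ η hζ hζ1 hθ T hT P hPdef
  have hQ := Finset.sum_le_sum fun y (_ : y ∈ (Finset.univ : Finset (Fin (b ^ D * (D * m)) → α))) =>
    sum_card_blockUnion_le hmem (hP y) hb hD hκ E hE (good y) (fun x c h1 h2 h3 => by
      rw [hend] at h2 h3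
      rw [hstart] at h3
      exact hgood y x c h1 h2 h3)
  have hZ := Finset.sum_le_sum fun y (_ : y ∈ (Finset.univ : Finset (Fin (b ^ D * (D * m)) → α))) =>
    sum_card_new_le (D := D) hmem (hP y) hb κ
  simp only [hend, length_weightedStream _ _ _ le_rfl, sum_treeWeight hb hm] at hQ
  rw [Finset.sum_comm, Finset.sum_add_distrib, ← Finset.mul_sum, ← Finset.mul_sum,
    Finset.sum_add_distrib, Finset.sum_sub_distrib, Finset.sum_const, Finset.sum_const, Finset.sum_const, Finset.card_univ,
    nsmul_eq_mul, nsmul_eq_mul, nsmul_eq_mul] at hQ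
  rw [Finset.sum_comm, Finset.sum_const, Finset.card_univ, nsmul_eq_mul] at hZ
  rw [Finset.sum_sub_distrib, Finset.sum_sub_distrib, ← Finset.sum_div, ← Finset.sum_div,
    Finset.sum_const, Finset.card_range, nsmul_eq_mul] at hsum
  have hfin : ∀ t, ∀ y : Fin (b ^ D * (D * m)) → α,
      weightedStream (treeWeight b D m κ) f y ((t + 1) * (D * m)) = P y (t + 1) := by
    subst hPdef; exact fun t y => rfl
  simp only [hfin]
  rw [le_div_iff₀ (by positivity)]
  refine le_trans (le_trans (le_of_eq ?_) (sub_le_sub (sub_le_sub_left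
    (div_le_div_of_nonneg_right hQ hu.le) _)
    (div_le_div_of_nonneg_right hZ (by positivity : 0 ≤ D * (ζ * (Fintype.card α : ℝ)))))) hsum
  obtain ⟨d, rfl⟩ : ∃ d, D = d + 1 := ⟨D - 1, by omega⟩
  rw [Nat.add_sub_cancel]
  push_cast
  have hpow : (b : ℝ) ^ (d + 1) = b ^ d * b := pow_succ _ _
  rw [hpow]
  field_simp
  ring

end TreeStream

/-! ### From averages over streams to one fixed stream -/

section Averaging

variable {Ω : Type*} [MeasurableSpace Ω]

open Classical in
-- Integrating the inequality turns indicators into probabilities; some member of a finite family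
-- reaches its average.
theorem exists_measure_ge_of_ae_average_ge (μ : Measure Ω) [IsProbabilityMeasure μ] {τ υ : Type*}
    (I : Finset τ) (hI : I.Nonempty) (J : Finset υ) (hJ : J.Nonempty) (X : τ → Set Ω)
    (G : υ → Set Ω) (hX : ∀ i, MeasurableSet (X i)) (hG : ∀ j, MeasurableSet (G j)) (a b g : ℝ)
    (hb : 0 ≤ b) (hg : ∀ j ∈ J, g ≤ μ.real (G j))
    (h : ∀ᵐ ω ∂μ, a + b * ((∑ j ∈ J, if ω ∈ G j then (1 : ℝ) else 0) / J.card) ≤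
      (∑ i ∈ I, if ω ∈ X i then (1 : ℝ) else 0) / I.card) :
    ∃ i ∈ I, a + b * g ≤ μ.real (X i) := by
  have hIc : (0 : ℝ) < I.card := by exact_mod_cast hI.card_pos
  have hJc : (0 : ℝ) < J.card := by exact_mod_cast hJ.card_pos
  have hint : ∀ A : Set Ω, MeasurableSet A →
      Integrable (fun ω => if ω ∈ A then (1 : ℝ) else 0) μ := by
    intro A hA
    have : (fun ω => if ω ∈ A then (1 : ℝ) else 0) = A.indicator fun _ => 1 := by
      ext ω; simp [Set.indicator]
    rw [this]
    exact (integrable_const 1).indicator hA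
  have hval : ∀ A : Set Ω, MeasurableSet A →
      ∫ ω, (if ω ∈ A then (1 : ℝ) else 0) ∂μ = μ.real A := by
    intro A hA
    have : (fun ω => if ω ∈ A then (1 : ℝ) else 0) = A.indicator 1 := by
      ext ω; simp [Set.indicator]
    rw [this, integral_indicator_one hA]
  have hmono := integral_mono_ae (μ := μ)
    ((integrable_const a).add (((integrable_finsetSum J fun j _ => hint _ (hG j)).div_const
      (J.card : ℝ)).const_mul b))
    ((integrable_finsetSum I fun i _ => hint _ (hX i)).div_const (I.card : ℝ)) h
  simp only [Pi.add_apply] at hmono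
  rw [integral_add (integrable_const a) (((integrable_finsetSum J fun j _ =>
    hint _ (hG j)).div_const (J.card : ℝ)).const_mul b), integral_const_mul, integral_div,
    integral_div, integral_finsetSum _ fun j _ => hint _ (hG j),
    integral_finsetSum _ fun i _ => hint _ (hX i)] at hmono
  simp only [hval _ (hG _), hval _ (hX _), integral_const, probReal_univ, smul_eq_mul,
    one_mul] at hmono
  by_contra hcon
  push Not at hcon
  have h1 : ∑ i ∈ I, μ.real (X i) < ∑ i ∈ I, (a + b * g) := Finset.sum_lt_sum_of_nonempty hI hcon
  rw [Finset.sum_const, nsmul_eq_mul] at h1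
  have h2 : J.card * g ≤ ∑ j ∈ J, μ.real (G j) := by
    rw [← nsmul_eq_mul, ← Finset.sum_const]
    exact Finset.sum_le_sum hg
  have h3 : g ≤ (∑ j ∈ J, μ.real (G j)) / J.card := by
    rw [le_div_iff₀ hJc]; linarith
  have h4 : (∑ i ∈ I, μ.real (X i)) / I.card < a + b * g := by
    rw [div_lt_iff₀ hIc]; linarith
  have h5 := mul_le_mul_of_nonneg_left h3 hb
  linarith

end Averaging

/-! ### Sketches as state maps; measurability; forced overestimates -/

namespace FESketch

variable {K Ω : Type*} [MeasurableSpace Ω] (S : FESketch K Ω)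

theorem runFrom_append (ω : Ω) (t : ℕ) (s : List Bool) (l r : List K) :
    S.runFrom ω t s (l ++ r) = S.runFrom ω (t + l.length) (S.runFrom ω t s l) r := by
  induction l generalizing t s with
  | nil => rfl
  | cons x l ih =>
    rw [List.cons_append, runFrom, runFrom, ih, List.length_cons]
    congr 1
    omega

theorem isStateMap_memory {α : Type*} (ι : α → K) (ω : Ω) :
    IsStateMap fun l : List α => S.memory ω (l.map ι) := by
  intro l l' r hl h
  simp only [memory, List.map_append, runFrom_append, List.length_map] at h ⊢
  rw [h, hl]

theorem measurableSet_runFrom (t : ℕ) (s : List Bool) (σ : List K) (s' : List Bool) :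
    MeasurableSet {ω | S.runFrom ω t s σ = s'} := by
  induction σ generalizing t s with
  | nil =>
    simp only [runFrom]
    exact MeasurableSet.const _
  | cons x σ ih =>
    have : {ω | S.runFrom ω t s (x :: σ) = s'} =
        ⋃ s'', {ω | S.update ω t s x = s''} ∩ {ω | S.runFrom ω (t + 1) s'' σ = s'} := by
      ext ω
      simp [runFrom]
    rw [this]
    exact MeasurableSet.iUnion fun s'' => (S.measurableSet_update t s x s'').inter (ih _ _)

theorem measurableSet_memory (σ : List K) (s : List Bool) :
    MeasurableSet {ω | S.memory ω σ = s} := by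
  have : {ω | S.memory ω σ = s} =
      ⋃ s', {ω | S.init ω = s'} ∩ {ω | S.runFrom ω 0 s' σ = s} := by
    ext ω
    simp [memory]
  rw [this]
  exact MeasurableSet.iUnion fun s' =>
    (S.measurableSet_init s').inter (S.measurableSet_runFrom 0 s' σ s)

theorem measurableSet_le_bits (σ : List K) (T : ℕ) : MeasurableSet {ω | T ≤ S.bits ω σ} := by
  have : {ω | T ≤ S.bits ω σ} =
      ⋃ s : List Bool, {ω | S.memory ω σ = s} ∩ {_ω | T ≤ s.length} := by
    ext ω
    simp [bits]
  rw [this]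
  exact MeasurableSet.iUnion fun s => (S.measurableSet_memory σ s).inter (MeasurableSet.const _)

theorem measurableSet_error_le (σ : List K) (x : K) (c e : ℝ) :
    MeasurableSet {ω | |S.estimate ω σ x - c| ≤ e} := by
  have : {ω | |S.estimate ω σ x - c| ≤ e} =
      ⋃ s : List Bool, {ω | S.memory ω σ = s} ∩ {ω | |S.query ω σ.length s x - c| ≤ e} := by
    ext ω
    simp [estimate]
  rw [this]
  refine MeasurableSet.iUnion fun s => (S.measurableSet_memory σ s).inter ?_
  exact measurableSet_le ((S.measurable_query _ _ _).sub_const c).abs measurable_const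

variable [DecidableEq K] {S}

/-- The estimate after `σ` is also the estimate after the alternative history `f ++ ρ`, where the
true count is at least `c`; in `σ` itself the count is zero. -/
theorem le_of_reach {α : Type*} [DecidableEq α] (ι : α ↪ K) {ω : Ω}
    (hω : ∀ (l : List α) (x : α), ((l.map ι).count (ι x) : ℝ) ≤ S.estimate ω (l.map ι) (ι x))
    {f σ : List α} {c : ℕ} {x : α} {e : ℝ}
    (h : Reach (fun l : List α => S.memory ω (l.map ι)) f σ.length (S.memory ω (σ.map ι)) c x)
    (hx : x ∉ σ) (he : |S.estimate ω (σ.map ι) (ι x) - ((σ.map ι).count (ι x) : ℝ)| ≤ e) :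
    (c : ℝ) ≤ e := by
  obtain ⟨ρ, hl, hm, hc⟩ := h
  have h0 : (σ.map ι).count (ι x) = 0 := by
    rw [List.count_map_of_injective _ _ ι.injective, List.count_eq_zero_of_not_mem hx]
  have h1 := hω (f ++ ρ) x
  have h2 : S.estimate ω ((f ++ ρ).map ι) (ι x) = S.estimate ω (σ.map ι) (ι x) := by
    have hm' : S.memory ω ((f ++ ρ).map ι) = S.memory ω (σ.map ι) := hm
    unfold estimate
    rw [hm', List.length_map, List.length_map, List.length_append, hl]
  rw [h2, List.count_map_of_injective _ _ ι.injective, List.count_append] at h1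
  rw [h0, Nat.cast_zero, sub_zero] at he
  have h3 : (c : ℝ) ≤ ((f.count x + ρ.count x : ℕ) : ℝ) := by exact_mod_cast (by omega)
  exact h3.trans (h1.trans ((le_abs_self _).trans he))

open Classical in
-- Restricting to a finite universe leaves countably many streams, so outside one null set no
-- estimate is too low after any of them, and the deterministic argument applies to every remaining
-- `ω`.
theorem exists_long_memory {μ : Measure Ω} [IsProbabilityMeasure μ] {E : ℕ → ℝ} {δ : ℝ}
    (hS : S.NeverUnderestimates μ) (hE : S.HasErrorBound μ E δ) {α : Type*} [Fintype α]
    [Nonempty α] (ι : α ↪ K) {τ υ : Type*} (I : Finset τ) (hI : I.Nonempty) [Fintype υ]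
    [Nonempty υ] (σ : τ → List α) (T : τ → ℕ) (last : υ → List α)
    (a b : ℝ) (hb : 0 ≤ b)
    (h : ∀ ω, (∀ (l : List α) (x : α),
        ((l.map ι).count (ι x) : ℝ) ≤ S.estimate ω (l.map ι) (ι x)) →
      a + b * ((∑ y, ∑ x, if |S.estimate ω ((last y).map ι) (ι x) -
        (((last y).map ι).count (ι x) : ℝ)| ≤ E (last y).length then (1 : ℝ) else 0) /
          (Fintype.card υ * Fintype.card α)) ≤
      (∑ i ∈ I, if T i ≤ (S.memory ω ((σ i).map ι)).length then (1 : ℝ) else 0) / I.card) :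
    ∃ i ∈ I, a + b * (1 - δ) ≤ μ.real {ω | T i ≤ S.bits ω ((σ i).map ι)} := by
  have hae : ∀ᵐ ω ∂μ, ∀ (l : List α) (x : α),
      ((l.map ι).count (ι x) : ℝ) ≤ S.estimate ω (l.map ι) (ι x) := by
    have : Countable α := Finite.to_countable
    exact ae_all_iff.2 fun l => ae_all_iff.2 fun x => hS _ _
  refine exists_measure_ge_of_ae_average_ge μ I hI (Finset.univ : Finset (υ × α))
    Finset.univ_nonempty (fun i => {ω | T i ≤ S.bits ω ((σ i).map ι)})
    (fun j => {ω | |S.estimate ω ((last j.1).map ι) (ι j.2) -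
        (((last j.1).map ι).count (ι j.2) : ℝ)| ≤ E (last j.1).length})
    (fun i => S.measurableSet_le_bits _ _) (fun j => S.measurableSet_error_le _ _ _ _) a b (1 - δ)
    hb (fun j _ => ?_) ?_
  · simpa only [List.length_map] using hE ((last j.1).map ι) (ι j.2)
  · filter_upwards [hae] with ω hω
    have h1 := h ω hω
    rw [← Finset.univ_product_univ, Finset.sum_product, Finset.card_product, Finset.card_univ,
      Finset.card_univ, Nat.cast_mul]
    convert h1 using 6
    rfl

end FESketch

/-! ### The three constructions applied to a sketch -/

namespace FESketch

variable {K Ω : Type*} [MeasurableSpace Ω] [DecidableEq K] {S : FESketch K Ω} {μ : Measure Ω}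
  [IsProbabilityMeasure μ] {E : ℕ → ℝ} {δ : ℝ}

theorem exists_stream_of_single_phase (hS : S.NeverUnderestimates μ) (hE : S.HasErrorBound μ E δ)
    {U : Finset K} (hU : U.Nonempty) {k n : ℕ} (hk : 0 < k) (hn : 0 < n) (a : ℕ)
    (hEk : E (a + n * k) < k) (ζ θ η : ℝ) (hζ : 0 < ζ) (hζ1 : ζ ≤ 1) (hθ : 0 ≤ θ) (T : ℕ)
    (hT : (2 : ℝ) ^ T * 2 ^ n * ζ ^ (θ * n) ≤ η) :
    ∃ σ : List K, σ.length = a + n * k ∧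
      (1 - θ - η) - (1 + (a + n * k : ℕ) / U.card) / ζ + (1 - δ) / ζ ≤
        μ.real {ω | T ≤ S.bits ω σ} := by
  classical
  obtain ⟨z, hz⟩ := hU
  have : Nonempty U := ⟨⟨z, hz⟩⟩
  set ι : U ↪ K := Function.Embedding.subtype (· ∈ U)
  -- Padding by a fixed key, so that `a + n * k` can be any prescribed length.
  set f : List U := List.replicate a ⟨z, hz⟩
  have hlen : ∀ y : Fin n → U, (weightedStream (fun _ => k) f y n).length = a + n * k := by
    intro y
    rw [length_weightedStream _ _ _ le_rfl]
    simp [f]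
  obtain ⟨y, -, hy⟩ := exists_long_memory hS hE ι (Finset.univ : Finset (Fin n → U))
    Finset.univ_nonempty (fun y => weightedStream (fun _ => k) f y n) (fun _ => T)
    (fun y : Fin n → U => weightedStream (fun _ => k) f y n)
    ((1 - θ - η) - (1 + (a + n * k : ℕ) / U.card) / ζ) (1 / ζ) (by positivity) (fun ω hω => by
      have key := long_states_of_single_phase (S.isStateMap_memory ι ω) hk f hn
        (fun y x => |S.estimate ω ((weightedStream (fun _ => k) f y n).map ι) (ι x) -
        (((weightedStream (fun _ => k) f y n).map ι).count (ι x) : ℝ)| ≤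
          E (weightedStream (fun _ => k) f y n).length)
        (fun y x hx hx' hV => by
          rw [phaseSet, mem_reachSet] at hV
          have := le_of_reach ι hω hV hx' hx
          rw [hlen] at this
          linarith) ζ θ η hζ hζ1 hθ T hT
      rw [Fintype.card_coe] at key ⊢
      rw [Finset.card_univ]
      refine le_trans (le_of_eq ?_) key
      simp only [f, List.length_replicate]
      rw [one_div, div_eq_mul_inv _ ζ, div_eq_mul_inv _ ζ, mul_comm (ζ⁻¹)])
  refine ⟨_, ?_, le_trans (le_of_eq ?_) hy⟩
  · rw [List.length_map, hlen]
  · ring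

theorem exists_stream_of_many_phases (hS : S.NeverUnderestimates μ) (hE : S.HasErrorBound μ E δ)
    {U : Finset K} (hU : U.Nonempty) {k n h : ℕ} (hn : 0 < n) (hh : 0 < h)
    (hEk : E (n * 2 ^ h * k) < k) (ζ θ η : ℝ) (hζ : 0 < ζ) (hζ1 : ζ ≤ 1) (hθ : 0 ≤ θ) (T : ℕ → ℕ)
    (hT : ∀ g < h, (2 : ℝ) ^ T g * 2 ^ (n * 2 ^ g) * ζ ^ (θ * (n * 2 ^ g : ℕ)) ≤ η) :
    ∃ g < h, ∃ σ : List K, σ.length = n * 2 ^ (g + 1) * k ∧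
      (1 - θ - η) - 1 / (h * ζ) - (1 + (n * 2 ^ h * k : ℕ) / U.card) + (1 - δ) ≤
        μ.real {ω | T g ≤ S.bits ω σ} := by
  classical
  obtain ⟨z, hz⟩ := hU
  have : Nonempty U := ⟨⟨z, hz⟩⟩
  set ι : U ↪ K := Function.Embedding.subtype (· ∈ U)
  -- Phase boundaries double, so each phase makes up half of the stream read so far and its `n * 2 ^
  -- g` symbols are comparable to the length divided by `k`.
  have hβ : StrictMono fun g : ℕ => n * 2 ^ g := by
    intro a b hab
    exact Nat.mul_lt_mul_of_pos_left (Nat.pow_lt_pow_right (by norm_num) hab) hn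
  have hsub : ∀ g, n * 2 ^ (g + 1) - n * 2 ^ g = n * 2 ^ g := by
    intro g
    rw [pow_succ, ← mul_assoc]
    omega
  have hlen : ∀ y : Fin (n * 2 ^ h) → U, ∀ g ≤ h,
      (weightedStream (fun _ => k) [] y (n * 2 ^ g)).length = n * 2 ^ g * k := by
    intro y g hg
    rw [length_weightedStream _ _ _ (hβ.monotone hg)]
    simp
  obtain ⟨⟨g, y⟩, hgy, hy⟩ := exists_long_memory hS hE ι
    (Finset.range h ×ˢ (Finset.univ : Finset (Fin (n * 2 ^ h) → U)))
    (Finset.nonempty_product.2 ⟨⟨0, Finset.mem_range.2 hh⟩, Finset.univ_nonempty⟩)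
    (fun i => weightedStream (fun _ => k) [] i.2 (n * 2 ^ (i.1 + 1))) (fun i => T i.1)
    (fun y : Fin (n * 2 ^ h) → U => weightedStream (fun _ => k) [] y (n * 2 ^ h))
    ((1 - θ - η) - 1 / (h * ζ) - (1 + (n * 2 ^ h * k : ℕ) / U.card)) 1 zero_le_one
    (fun ω hω => by
      have key := long_states_of_many_phases (S.isStateMap_memory ι ω) [] hh _ hβ rfl
        (fun y x => |S.estimate ω ((weightedStream (fun _ => k) [] y (n * 2 ^ h)).map ι) (ι x) -
        (((weightedStream (fun _ => k) [] y (n * 2 ^ h)).map ι).count (ι x) : ℝ)| ≤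
          E (weightedStream (fun _ => k) [] y (n * 2 ^ h)).length)
        (fun y x hx hx' hV => by
          rw [phaseSet, mem_reachSet] at hV
          have := le_of_reach ι hω hV hx' hx
          rw [hlen y h le_rfl] at this
          linarith) ζ θ η hζ hζ1 hθ T (by simpa only [hsub] using hT)
      rw [Fintype.card_coe] at key ⊢
      rw [Finset.card_product, Finset.card_univ, Finset.card_range, Finset.sum_product,
        Nat.cast_mul h, one_mul]
      simpa only [List.length_nil, zero_add] using key)
  have hg := Finset.mem_range.1 (Finset.mem_product.1 hgy).1
  refine ⟨g, hg, _, ?_, le_trans (le_of_eq ?_) hy⟩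
  · rw [List.length_map, hlen _ _ hg]
  · ring

theorem exists_stream_of_tree (hS : S.NeverUnderestimates μ) (hE : S.HasErrorBound μ E δ)
    {U : Finset K} (hU : U.Nonempty) {b D m κ : ℕ} (hb : 0 < b) (hD : 0 < D)
    (hm : 0 < m) (hκ : 0 < κ) (a : ℕ) (hE0 : 0 ≤ E (a + D * m * (κ * b ^ D)))
    (ζ θ η : ℝ) (hζ : 0 < ζ) (hζ1 : ζ ≤ 1) (hθ : 0 ≤ θ) (T : ℕ)
    (hT : (2 : ℝ) ^ T * 2 ^ (D * m) * ζ ^ (θ * (D * m : ℕ)) ≤ η) :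
    ∃ σ : List K, a ≤ σ.length ∧ σ.length ≤ a + D * m * (κ * b ^ D) ∧
      (1 - θ - η) - (1 + D / b) / (D * ζ)
      - (E (a + D * m * (κ * b ^ D)) / (κ * b ^ D) + 1 +
        (a + D * m * (κ * b ^ D) : ℕ) / U.card) + (1 - δ) ≤
        μ.real {ω | T ≤ S.bits ω σ} := by
  classical
  obtain ⟨z, hz⟩ := hU
  have : Nonempty U := ⟨⟨z, hz⟩⟩
  set ι : U ↪ K := Function.Embedding.subtype (· ∈ U)
  -- The padding keeps the lengths at all leaves between `a` and the full length; with `a` large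
  -- they are comparable.
  set f : List U := List.replicate a ⟨z, hz⟩
  set w := treeWeight b D m κ with hw
  have hf : f.length = a := by simp [f]
  have hlen : ∀ y : Fin (b ^ D * (D * m)) → U,
      (weightedStream w f y (b ^ D * (D * m))).length = a + D * m * (κ * b ^ D) := by
    intro y
    rw [length_weightedStream _ _ _ le_rfl, hw, sum_treeWeight hb hm, hf]
  obtain ⟨⟨t, y⟩, hty, hy⟩ := exists_long_memory hS hE ι
    (Finset.range (b ^ D) ×ˢ (Finset.univ : Finset (Fin (b ^ D * (D * m)) → U)))
    (Finset.nonempty_product.2 ⟨⟨0, Finset.mem_range.2 (pow_pos hb D)⟩, Finset.univ_nonempty⟩)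
    (fun i => weightedStream w f i.2 ((i.1 + 1) * (D * m))) (fun _ => T)
    (fun y : Fin (b ^ D * (D * m)) → U => weightedStream w f y (b ^ D * (D * m)))
    ((1 - θ - η) - (1 + D / b) / (D * ζ)
      - (E (a + D * m * (κ * b ^ D)) / (κ * b ^ D) + 1 +
        (a + D * m * (κ * b ^ D) : ℕ) / U.card)) 1 zero_le_one
    (fun ω hω => by
      have key := long_states_of_tree (S.isStateMap_memory ι ω) hb hD hm hκ f ζ θ η hζ hζ1 hθ T hT
        (E (a + D * m * (κ * b ^ D))) hE0
        (fun y x => |S.estimate ω ((weightedStream w f y (b ^ D * (D * m))).map ι) (ι x) -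
        (((weightedStream w f y (b ^ D * (D * m))).map ι).count (ι x) : ℝ)| ≤
          E (weightedStream w f y (b ^ D * (D * m))).length)
        (fun y x c hx hx' hV => by
          have := le_of_reach ι hω hV hx' hx
          rwa [hlen] at this)
      rw [Fintype.card_coe, hf] at key
      rw [Fintype.card_coe, Finset.card_product, Finset.card_univ, Finset.card_range,
        Finset.sum_product, Nat.cast_mul, one_mul, Nat.cast_pow]
      exact key)
  have ht := Finset.mem_range.1 (Finset.mem_product.1 hty).1
  refine ⟨_, ?_, ?_, le_trans (le_of_eq ?_) hy⟩
  · rw [List.length_map, length_weightedStream _ _ _ (Nat.mul_le_mul_right _ ht), hf]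
    exact Nat.le_add_right _ _
  · rw [List.length_map, ← hlen y]
    obtain ⟨ρ, hρ⟩ := weightedStream_prefix w f y (Nat.mul_le_mul_right (D * m) ht)
    rw [hρ, List.length_append]
    exact Nat.le_add_right _ _
  · ring

end FESketch

/-! ### Dichotomy for the growth of the error bound -/

section Dyadic

/-- Either the error bound is nearly constant on a long window of dyadic lengths, or it is large. -/
theorem flat_window_or_large {E : ℕ → ℝ} (hmono : Monotone E) (hE1 : ∀ N, 1 ≤ E N) {N₁ Λ : ℕ}
    {x : ℝ} (hΛ : 2 ≤ Λ) (hx : (2 : ℝ) ^ (2 * Λ ^ 4) ≤ x) (hN : x ^ 4 * E N₁ = N₁) :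
    (∃ i, E (2 ^ (i + Λ ^ 2)) ≤ 2 * E (2 ^ i) ∧ 4 * x ^ 2 * E (2 ^ i) < 2 ^ i ∧
      x * 2 ^ (i + Λ ^ 2) ≤ N₁) ∨
    ∃ i, E (2 ^ (i + 1)) ≤ 2 * E (2 ^ i) ∧ x ^ 3 * E (2 ^ i) ≤ 2 * 2 ^ i ∧ x * 2 ^ i ≤ N₁ ∧
      2 ^ (i + 1) ≤ N₁ ∧ (2 : ℝ) ^ (Λ ^ 2) ≤ E (2 ^ i) := by
  classical
  have hq : 16 ≤ Λ ^ 4 := by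
    calc 16 = 2 ^ 4 := by norm_num
      _ ≤ Λ ^ 4 := Nat.pow_le_pow_left hΛ 4
  have hx32 : (32 : ℝ) ≤ x := by
    calc (32 : ℝ) = 2 ^ 5 := by norm_num
      _ ≤ 2 ^ (2 * Λ ^ 4) := pow_le_pow_right₀ (by norm_num) (by omega)
      _ ≤ x := hx
  have hx0 : 0 < x := by linarith
  have hEpos : ∀ N, 0 < E N := fun N => lt_of_lt_of_le one_pos (hE1 N)
  have hE2 : ∀ i j : ℕ, i ≤ j → E (2 ^ i) ≤ E (2 ^ j) := fun i j hij =>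
    hmono (Nat.pow_le_pow_right (by norm_num) hij)
  have hN0 : N₁ ≠ 0 := by
    rintro rfl
    have : 0 < x ^ 4 * E 0 := mul_pos (by positivity) (hEpos 0)
    rw [hN] at this
    simp at this
  set I := Nat.log 2 N₁ with hI
  have hI1 : 2 ^ I ≤ N₁ := Nat.pow_log_le_self 2 hN0
  have hI2 : N₁ < 2 ^ (I + 1) := Nat.lt_pow_succ_log_self (by norm_num) N₁
  have hEI : E (2 ^ I) ≤ E N₁ := hmono hI1
  -- the last dyadic length below the density `x ^ 3`
  set i₁ := Nat.findGreatest (fun i => (2 : ℝ) ^ i < x ^ 3 * E (2 ^ i)) I with hi₁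
  have h0 : (2 : ℝ) ^ 0 < x ^ 3 * E (2 ^ 0) := by
    have : (1 : ℝ) < x ^ 3 := one_lt_pow₀ (by linarith) (by norm_num)
    have h1 := hE1 (2 ^ 0)
    nlinarith
  have hlow : (2 : ℝ) ^ i₁ < x ^ 3 * E (2 ^ i₁) :=
    Nat.findGreatest_spec (P := fun i => (2 : ℝ) ^ i < x ^ 3 * E (2 ^ i)) (Nat.zero_le I) h0
  have hle : i₁ ≤ I := Nat.findGreatest_le I
  -- At the last dyadic length the density is still above `x ^ 4 / 2`, hence above `x ^ 3`.
  have hne : i₁ ≠ I := by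
    intro h
    rw [h] at hlow
    have h1 : (N₁ : ℝ) < 2 ^ (I + 1) := by exact_mod_cast hI2
    have h2 : x ^ 3 * E (2 ^ I) ≤ x ^ 3 * E N₁ := mul_le_mul_of_nonneg_left hEI (by positivity)
    have h3 : x ^ 4 * E N₁ = x * (x ^ 3 * E N₁) := by ring
    have h4 : 0 < x ^ 3 * E N₁ := mul_pos (by positivity) (hEpos _)
    have h5 : 2 * (x ^ 3 * E N₁) ≤ x * (x ^ 3 * E N₁) :=
      mul_le_mul_of_nonneg_right (by linarith) h4.le
    rw [pow_succ] at h1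
    linarith
  have hlt : i₁ < I := lt_of_le_of_ne hle hne
  have hhigh : x ^ 3 * E (2 ^ (i₁ + 1)) ≤ 2 ^ (i₁ + 1) := by
    have := Nat.findGreatest_is_greatest (P := fun i => (2 : ℝ) ^ i < x ^ 3 * E (2 ^ i))
      (Nat.lt_succ_self i₁) hlt
    simpa using this
  -- The density crosses `x ^ 3` in this step while the length only doubles, so `E` at most doubles.
  have hstep : E (2 ^ (i₁ + 1)) ≤ 2 * E (2 ^ i₁) := by
    have h1 : x ^ 3 * E (2 ^ (i₁ + 1)) ≤ x ^ 3 * (2 * E (2 ^ i₁)) := by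
      rw [pow_succ (2 : ℝ)] at hhigh
      linarith
    exact le_of_mul_le_mul_left h1 (by positivity)
  have hr1 : x ^ 3 * E (2 ^ i₁) ≤ 2 * 2 ^ i₁ := by
    have h1 := mul_le_mul_of_nonneg_left (hE2 i₁ (i₁ + 1) (Nat.le_succ _))
      (by positivity : 0 ≤ x ^ 3)
    rw [pow_succ (2 : ℝ)] at hhigh
    linarith
  have hxN : x * 2 ^ i₁ ≤ N₁ := by
    have h1 : E (2 ^ i₁) ≤ E N₁ := (hE2 _ _ hle).trans hEI
    calc x * 2 ^ i₁ ≤ x * (x ^ 3 * E (2 ^ i₁)) := mul_le_mul_of_nonneg_left hlow.le hx0.le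
      _ = x ^ 4 * E (2 ^ i₁) := by ring
      _ ≤ x ^ 4 * E N₁ := mul_le_mul_of_nonneg_left h1 (by positivity)
      _ = N₁ := hN
  -- the last dyadic length up to there with density at most `4 * x ^ 2`
  set i₀ := Nat.findGreatest (fun i => (2 : ℝ) ^ i ≤ 4 * x ^ 2 * E (2 ^ i)) i₁ with hi₀
  have h0' : (2 : ℝ) ^ 0 ≤ 4 * x ^ 2 * E (2 ^ 0) := by
    have : (1 : ℝ) < x ^ 2 := one_lt_pow₀ (by linarith) (by norm_num)
    have h1 := hE1 (2 ^ 0)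
    nlinarith
  have hlow0 : (2 : ℝ) ^ i₀ ≤ 4 * x ^ 2 * E (2 ^ i₀) :=
    Nat.findGreatest_spec (P := fun i => (2 : ℝ) ^ i ≤ 4 * x ^ 2 * E (2 ^ i)) (Nat.zero_le i₁) h0'
  have hle0 : i₀ ≤ i₁ := Nat.findGreatest_le i₁
  have hhigh0 : ∀ i, i₀ < i → i ≤ i₁ → 4 * x ^ 2 * E (2 ^ i) < 2 ^ i := by
    intro i h1 h2
    have := Nat.findGreatest_is_greatest (P := fun i => (2 : ℝ) ^ i ≤ 4 * x ^ 2 * E (2 ^ i)) h1 h2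
    simpa using this
  -- The density at most doubles per step and must rise from at most `4 * x ^ 2` to at least `x ^ 3
  -- / 2`; since `x` is at least `2 ^ (2 * Λ ^ 4)`, this takes more than `Λ ^ 4` steps.
  have hD : i₀ + Λ ^ 4 + 1 ≤ i₁ := by
    by_contra hcon
    push Not at hcon
    have h1 : (2 : ℝ) ^ i₁ ≤ 2 ^ i₀ * 2 ^ (Λ ^ 4) := by
      rw [← pow_add]
      exact pow_le_pow_right₀ (by norm_num) (by omega)
    have h2 : (2 : ℝ) ^ (Λ ^ 4) * 16 ≤ x := by
      calc (2 : ℝ) ^ (Λ ^ 4) * 16 = 2 ^ (Λ ^ 4 + 4) := by rw [pow_add]; norm_num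
        _ ≤ 2 ^ (2 * Λ ^ 4) := pow_le_pow_right₀ (by norm_num) (by omega)
        _ ≤ x := hx
    have h3 : E (2 ^ i₀) ≤ E (2 ^ i₁) := hE2 _ _ hle0
    have h4 : (2 : ℝ) ^ i₁ ≤ 4 * x ^ 2 * E (2 ^ i₁) * 2 ^ (Λ ^ 4) :=
      h1.trans (mul_le_mul_of_nonneg_right
        (hlow0.trans (mul_le_mul_of_nonneg_left h3 (by positivity))) (by positivity))
    have h5 : 0 < x ^ 2 * E (2 ^ i₁) := mul_pos (by positivity) (hEpos _)
    have h6 : x ^ 2 * E (2 ^ i₁) * (2 ^ (Λ ^ 4) * 16) ≤ x ^ 2 * E (2 ^ i₁) * x :=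
      mul_le_mul_of_nonneg_left h2 h5.le
    have h7 : x ^ 3 * E (2 ^ i₁) = x ^ 2 * E (2 ^ i₁) * x := by ring
    have h8 : 0 < x ^ 2 * E (2 ^ i₁) * 2 ^ (Λ ^ 4) := by positivity
    nlinarith
  have hsq : Λ ^ 4 = Λ ^ 2 * Λ ^ 2 := by ring
  by_cases hflat : ∃ i, i₀ < i ∧ i + Λ ^ 2 ≤ i₁ ∧ E (2 ^ (i + Λ ^ 2)) ≤ 2 * E (2 ^ i)
  · obtain ⟨i, h1, h2, h3⟩ := hflat
    refine Or.inl ⟨i, h3, hhigh0 i h1 (by omega), le_trans ?_ hxN⟩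
    exact mul_le_mul_of_nonneg_left (pow_le_pow_right₀ (by norm_num) h2) hx0.le
  · push Not at hflat
    -- Without a flat window, `E` more than doubles over each of the `Λ ^ 2` consecutive windows of
    -- length `Λ ^ 2` ending at `i₁`.
    have hgrow : ∀ j, j ≤ Λ ^ 2 → (2 : ℝ) ^ j ≤ E (2 ^ (i₁ - Λ ^ 4 + j * Λ ^ 2)) := by
      intro j
      induction j with
      | zero => intro _; simpa using hE1 _
      | succ j ih =>
        intro hj
        have h1 : j * Λ ^ 2 + Λ ^ 2 ≤ Λ ^ 4 := by
          rw [hsq]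
          calc j * Λ ^ 2 + Λ ^ 2 = (j + 1) * Λ ^ 2 := by ring
            _ ≤ _ := Nat.mul_le_mul_right _ hj
        have h2 := hflat (i₁ - Λ ^ 4 + j * Λ ^ 2) (by omega) (by omega)
        have h3 : i₁ - Λ ^ 4 + (j + 1) * Λ ^ 2 = i₁ - Λ ^ 4 + j * Λ ^ 2 + Λ ^ 2 := by ring
        rw [h3, pow_succ]
        have := ih (by omega)
        linarith
    have h1 := hgrow (Λ ^ 2) le_rfl
    rw [← hsq, Nat.sub_add_cancel (by omega)] at h1
    exact Or.inr ⟨i₁, hstep, hr1, hxN, (Nat.pow_le_pow_right (by norm_num) hlt).trans hI1, h1⟩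

end Dyadic

/-! ### The memory threshold allowed by the union bound -/

section Threshold

/-- Compare exponents of 2. Of the `2 * n` subtracted, one `n` pays for `2 ^ n` and the other for
rounding up; `n * logb 2 (1 / η)` covers `η`, both because `1 ≤ n`. -/
theorem two_pow_ceil_mul_le {n : ℕ} (hn : 1 ≤ n) {ζ θ η : ℝ} (hζ : 0 < ζ) (hη : 0 < η)
    (hη1 : η ≤ 1) (hY : 0 ≤ θ * Real.logb 2 (1 / ζ) - 2 - Real.logb 2 (1 / η)) :
    (2 : ℝ) ^ ⌈(n : ℝ) * (θ * Real.logb 2 (1 / ζ) - 2 - Real.logb 2 (1 / η))⌉₊ * 2 ^ n *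
      ζ ^ (θ * n) ≤ η := by
  have hnR : (1 : ℝ) ≤ n := by exact_mod_cast hn
  set Y := θ * Real.logb 2 (1 / ζ) - 2 - Real.logb 2 (1 / η) with hYdef
  have h1 : ζ ^ (θ * n) = (2 : ℝ) ^ (Real.logb 2 ζ * (θ * n)) := by
    rw [Real.rpow_mul (by norm_num : (0 : ℝ) ≤ 2) (Real.logb 2 ζ) (θ * n),
      Real.rpow_logb (by norm_num) (by norm_num) hζ]
  have h2 : η = (2 : ℝ) ^ (Real.logb 2 η) :=
    (Real.rpow_logb (by norm_num) (by norm_num) hη).symm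
  have h3 : (⌈(n : ℝ) * Y⌉₊ : ℝ) ≤ n * Y + 1 := (Nat.ceil_lt_add_one (by positivity)).le
  have h4 : Real.logb 2 η ≤ 0 := Real.logb_nonpos (by norm_num) hη.le hη1
  rw [h1, ← Real.rpow_natCast, ← Real.rpow_natCast, ← Real.rpow_add (by norm_num),
    ← Real.rpow_add (by norm_num)]
  conv_rhs => rw [h2]
  refine Real.rpow_le_rpow_of_exponent_le (by norm_num) ?_
  have h5 : n * Y = -(Real.logb 2 ζ * (θ * n)) - 2 * n + n * Real.logb 2 η := by
    rw [hYdef, one_div, one_div, Real.logb_inv, Real.logb_inv]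
    ring
  have h6 : n * Real.logb 2 η ≤ 1 * Real.logb 2 η := mul_le_mul_of_nonpos_right hnR h4
  linarith

end Threshold

/-! ### Choice of parameters in the three constructions -/

namespace FESketch

variable {K Ω : Type*} [MeasurableSpace Ω] {S : FESketch K Ω} {μ : Measure Ω}
  [IsProbabilityMeasure μ] {E : ℕ → ℝ} {δ : ℝ}

theorem measure_le_bits_mono (σ : List K) {T : ℕ} {X Y : ℝ} (hT : T = ⌈Y⌉₊) (hXY : X ≤ Y) {p : ℝ}
    (h : p ≤ μ.real {ω | T ≤ S.bits ω σ}) : p ≤ μ.real {ω | X ≤ (S.bits ω σ : ℝ)} := by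
  refine h.trans (measureReal_mono fun ω hω => ?_)
  have h1 : T ≤ S.bits ω σ := hω
  have h2 : Y ≤ (S.bits ω σ : ℝ) := (Nat.le_ceil Y).trans (by exact_mod_cast hT ▸ h1)
  exact hXY.trans h2

theorem floor_add_one_le {e : ℝ} (he : 1 ≤ e) : ((⌊e⌋₊ + 1 : ℕ) : ℝ) ≤ 2 * e := by
  have := Nat.floor_le (zero_le_one.trans he)
  push_cast
  linarith

variable [DecidableEq K]

/-- The `log (1 / δ)` bound. -/
theorem exists_stream_logb_inv (hS : S.NeverUnderestimates μ) (hE : S.HasErrorBound μ E δ)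
    (hE1 : ∀ N, 1 ≤ E N) (hδ : 0 < δ) (hlog : 19 ≤ Real.logb 2 (1 / δ)) {N : ℕ} (hN : E N < N)
    {U : Finset K} (hU : (N : ℝ) / δ ≤ U.card) {X : ℝ}
    (hX : X ≤ N / E N * (Real.logb 2 (1 / δ) / 16 - 2)) :
    ∃ σ : List K, σ.length = N ∧ 1 / 4 ≤ μ.real {ω | X ≤ (S.bits ω σ : ℝ)} := by
  have hE0 : 0 < E N := one_pos.trans_le (hE1 N)
  have hN0 : (0 : ℝ) < N := hE0.trans hN
  have hδ8 : 8 * δ ≤ 1 := by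
    by_contra hcon
    push Not at hcon
    have h1 : Real.logb 2 (1 / δ) ≤ Real.logb 2 8 :=
      Real.logb_le_logb_of_le (by norm_num) (by positivity) (by
        rw [div_le_iff₀ hδ]; linarith)
    have h2 : Real.logb 2 8 = 3 := by
      rw [show (8 : ℝ) = 2 ^ (3 : ℝ) by norm_num]
      exact Real.logb_rpow (by norm_num) (by norm_num)
    linarith
  have hUc : (0 : ℝ) < U.card := (div_pos hN0 hδ).trans_le hU
  have hUne : U.Nonempty := Finset.card_pos.1 (by exact_mod_cast hUc)
  -- The least integer multiplicity exceeding `E N`: a confused key outside the stream then violates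
  -- the error bound.
  set k := ⌊E N⌋₊ + 1 with hk
  have hEk : E N < k := by rw [hk]; push_cast; exact Nat.lt_floor_add_one _
  have hk2 : (k : ℝ) ≤ 2 * E N := floor_add_one_le (hE1 N)
  have hkN : k ≤ N := by
    have : ⌊E N⌋₊ < N := (Nat.floor_lt hE0.le).2 hN
    omega
  have hkpos : 0 < k := Nat.succ_pos _
  have hn : 0 < N / k := Nat.div_pos hkN hkpos
  have hNk : N % k + N / k * k = N := by
    have := Nat.mod_add_div N k
    rw [mul_comm] at this
    exact this
  have hlog8 : Real.logb 2 (1 / (8 * δ)) = Real.logb 2 (1 / δ) - 3 := by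
    rw [one_div, one_div, Real.logb_inv, Real.logb_inv, Real.logb_mul (by norm_num) hδ.ne',
      show (8 : ℝ) = 2 ^ (3 : ℝ) by norm_num, Real.logb_rpow (by norm_num) (by norm_num)]
    ring
  have hlog4 : Real.logb 2 (1 / (1 / 4 : ℝ)) = 2 := by
    rw [show (1 / (1 / 4 : ℝ)) = 2 ^ (2 : ℝ) by norm_num]
    exact Real.logb_rpow (by norm_num) (by norm_num)
  -- The confused set has mean density at most `δ + N / U.card ≤ 2 * δ`, so `ζ = 8 * δ` makes the
  -- Markov loss at most `1 / 4`; with `θ = η = 1 / 4` this leaves probability `1 / 4`.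
  have hT := two_pow_ceil_mul_le (n := N / k) hn (ζ := 8 * δ) (θ := 1 / 4) (η := 1 / 4)
    (by linarith) (by norm_num) (by norm_num) (by rw [hlog8, hlog4]; linarith)
  obtain ⟨σ, hσ, hp⟩ := exists_stream_of_single_phase hS hE hUne hkpos hn (N % k)
    (by rw [hNk]; exact hEk) (8 * δ) (1 / 4) (1 / 4) (by linarith) hδ8 (by norm_num) _ hT
  rw [hNk] at hσ hp
  refine ⟨σ, hσ, ?_⟩
  have hNU : (N : ℝ) / U.card ≤ δ := by
    rw [div_le_iff₀ hδ] at hU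
    rw [div_le_iff₀ hUc]
    linarith
  refine measure_le_bits_mono σ rfl ?_ (le_trans ?_ hp)
  · refine hX.trans ?_
    rw [hlog8, hlog4]
    have h1 : (N : ℝ) / E N ≤ 4 * ((N / k : ℕ) : ℝ) := by
      rw [div_le_iff₀ hE0]
      have h2 : (N : ℝ) ≤ 2 * (((N / k : ℕ) : ℝ) * k) := by
        have h3 : N % k < k := Nat.mod_lt _ hkpos
        have h4 : k ≤ N / k * k := Nat.le_mul_of_pos_left _ hn
        exact_mod_cast (by omega : N ≤ 2 * (N / k * k))
      have h5 : ((N / k : ℕ) : ℝ) * k ≤ ((N / k : ℕ) : ℝ) * (2 * E N) :=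
        mul_le_mul_of_nonneg_left hk2 (Nat.cast_nonneg _)
      linarith
    by_cases hneg : Real.logb 2 (1 / δ) / 16 - 2 ≤ 0
    · refine (mul_nonpos_of_nonneg_of_nonpos (by positivity) hneg).trans ?_
      exact mul_nonneg (Nat.cast_nonneg _) (by linarith)
    · push Not at hneg
      refine (mul_le_mul_of_nonneg_right h1 hneg.le).trans ?_
      rw [mul_comm (4 : ℝ), mul_assoc]
      exact mul_le_mul_of_nonneg_left (by linarith) (Nat.cast_nonneg _)
  · have h1 : (1 + (N : ℝ) / U.card) / (8 * δ) - (1 - δ) / (8 * δ) ≤ 1 / 4 := by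
      rw [← sub_div, div_le_iff₀ (by linarith)]
      linarith
    linarith

/-- The bound on a window of lengths on which the error bound is nearly constant. -/
theorem exists_stream_of_flat_window (hS : S.NeverUnderestimates μ) (hE : S.HasErrorBound μ E δ)
    (hmono : Monotone E) (hE1 : ∀ N, 1 ≤ E N) {γ : ℝ} (hγ : 0 < γ) (hγ1 : γ < 1)
    (hδ : γ ≤ 1 - δ) {i h Λ : ℕ} (hΛ : 16 / γ ≤ Λ) (hh : Λ ≤ h)
    (hflat : E (2 ^ (i + h)) ≤ 2 * E (2 ^ i)) (hi : 4 * E (2 ^ i) ≤ 2 ^ i) {U : Finset K}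
    (hU : 2 ^ (i + h) ≤ γ / 8 * U.card)
    (hY : 0 ≤ γ / 8 * Real.logb 2 (1 / (16 / (γ * Λ))) - 2 - Real.logb 2 (1 / (γ / 8))) :
    ∃ N, 2 ^ i ≤ N ∧ N ≤ 2 ^ (i + h) ∧ ∃ σ : List K, σ.length = N ∧ ∀ X : ℝ,
      X ≤ N / E N * (1 / 8 *
        (γ / 8 * Real.logb 2 (1 / (16 / (γ * Λ))) - 2 - Real.logb 2 (1 / (γ / 8)))) →
      γ / 4 ≤ μ.real {ω | X ≤ (S.bits ω σ : ℝ)} := by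
  set Y := γ / 8 * Real.logb 2 (1 / (16 / (γ * Λ))) - 2 - Real.logb 2 (1 / (γ / 8)) with hYdef
  have hEpos : ∀ N, 0 < E N := fun N => one_pos.trans_le (hE1 N)
  have hΛ0 : (0 : ℝ) < Λ := lt_of_lt_of_le (by positivity) hΛ
  have hUc : (0 : ℝ) < U.card := by
    have : (0 : ℝ) < γ / 8 * U.card := lt_of_lt_of_le (by positivity) hU
    exact pos_of_mul_pos_right this (by positivity)
  have hUne : U.Nonempty := Finset.card_pos.1 (by exact_mod_cast hUc)
  have hζ : 0 < 16 / (γ * Λ) := by positivity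
  have hζ1 : 16 / (γ * Λ) ≤ 1 := by
    rw [div_le_iff₀ hγ] at hΛ
    rw [div_le_one (by positivity)]
    linarith
  have hh0 : 0 < h := by
    have : 0 < Λ := by exact_mod_cast hΛ0
    omega
  set k := ⌊E (2 ^ (i + h))⌋₊ + 1 with hk
  have hEk : E (2 ^ (i + h)) < k := by rw [hk]; push_cast; exact Nat.lt_floor_add_one _
  have hkpos : 0 < k := Nat.succ_pos _
  have hk4 : (k : ℝ) ≤ 4 * E (2 ^ i) := (floor_add_one_le (hE1 _)).trans (by linarith)
  have hk2i : k ≤ 2 ^ i := by exact_mod_cast hk4.trans hi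
  set n := 2 ^ i / k with hn
  have hn0 : 0 < n := Nat.div_pos hk2i hkpos
  have hnk : n * k ≤ 2 ^ i := Nat.div_mul_le_self _ _
  have hnk2 : 2 ^ i ≤ 2 * (n * k) := by
    have h1 : 2 ^ i < n * k + k := Nat.lt_div_mul_add hkpos
    have h2 : k ≤ n * k := Nat.le_mul_of_pos_left _ hn0
    omega
  have hlen : ∀ g, n * 2 ^ g * k ≤ 2 ^ (i + g) := by
    intro g
    rw [pow_add, mul_right_comm]
    exact Nat.mul_le_mul_right _ hnk
  -- From confidence `γ` are lost `γ / 4` to `θ` and `η`, `γ / 16` to growth (as `Λ ≤ h`), and `γ /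
  -- 8` to keys of the stream, which leaves more than `γ / 4`.
  obtain ⟨g, hg, σ, hσ, hp⟩ := exists_stream_of_many_phases hS hE hUne hn0 hh0
    (lt_of_le_of_lt (hmono (hlen h)) hEk) (16 / (γ * Λ)) (γ / 8) (γ / 8) hζ hζ1 (by positivity)
    (fun g => ⌈((n * 2 ^ g : ℕ) : ℝ) * Y⌉₊) (fun g _ => two_pow_ceil_mul_le
      (Nat.mul_pos hn0 (pow_pos (by norm_num) g)) hζ (by positivity) (by linarith) hY)
  have hlow : 2 ^ (i + g) ≤ n * 2 ^ (g + 1) * k := by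
    calc 2 ^ (i + g) = 2 ^ i * 2 ^ g := pow_add _ _ _
      _ ≤ 2 * (n * k) * 2 ^ g := Nat.mul_le_mul_right _ hnk2
      _ = n * 2 ^ (g + 1) * k := by ring
  have hN1 : 2 ^ i ≤ n * 2 ^ (g + 1) * k :=
    (Nat.pow_le_pow_right (by norm_num) (Nat.le_add_right i g)).trans hlow
  have hN2 : n * 2 ^ (g + 1) * k ≤ 2 ^ (i + h) :=
    (hlen (g + 1)).trans (Nat.pow_le_pow_right (by norm_num) (by omega))
  refine ⟨n * 2 ^ (g + 1) * k, hN1, hN2, σ, hσ, fun X hX => ?_⟩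
  refine measure_le_bits_mono σ rfl (hX.trans ?_) (le_trans ?_ hp)
  · rw [← mul_assoc]
    refine mul_le_mul_of_nonneg_right ?_ hY
    have h1 : E (2 ^ i) ≤ E (n * 2 ^ (g + 1) * k) := hmono hN1
    rw [mul_one_div, div_div, div_le_iff₀ (mul_pos (hEpos _) (by norm_num))]
    calc ((n * 2 ^ (g + 1) * k : ℕ) : ℝ) = ((n * 2 ^ g : ℕ) : ℝ) * (2 * k) := by
          push_cast; ring
      _ ≤ ((n * 2 ^ g : ℕ) : ℝ) * (E (n * 2 ^ (g + 1) * k) * 8) :=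
          mul_le_mul_of_nonneg_left (by linarith) (Nat.cast_nonneg _)
  · have h1 : 1 / (h * (16 / (γ * Λ))) ≤ γ / 16 := by
      have hhR : (Λ : ℝ) ≤ h := by exact_mod_cast hh
      have hhR0 : (0 : ℝ) < h := hΛ0.trans_le hhR
      rw [div_le_iff₀ (by positivity)]
      field_simp
      exact hhR
    have h2 : ((n * 2 ^ h * k : ℕ) : ℝ) / U.card ≤ γ / 8 := by
      rw [div_le_iff₀ hUc]
      exact le_trans (by exact_mod_cast hlen h) hU
    linarith

/-- The bound at a length at which the error bound is large. -/
theorem exists_stream_of_large_error (hS : S.NeverUnderestimates μ) (hE : S.HasErrorBound μ E δ)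
    (hmono : Monotone E) (hE1 : ∀ N, 1 ≤ E N) {γ : ℝ} (hγ : 0 < γ) (hγ1 : γ < 1)
    (hδ : γ ≤ 1 - δ) {i Λ : ℕ} (hΛ : 16 / γ ≤ Λ) (hlarge : (Λ : ℝ) ^ Λ ≤ E (2 ^ i))
    (hflat : E (2 ^ (i + 1)) ≤ 2 * E (2 ^ i)) (hi : 18 * Λ / γ * E (2 ^ i) ≤ 2 ^ i) {U : Finset K}
    (hU : 2 ^ (i + 1) ≤ γ / 8 * U.card)
    (hY : 0 ≤ γ / 8 * Real.logb 2 (1 / (16 / (γ * Λ))) - 2 - Real.logb 2 (1 / (γ / 8))) :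
    ∃ N, 2 ^ i ≤ N ∧ N ≤ 2 ^ (i + 1) ∧ ∃ σ : List K, σ.length = N ∧ ∀ X : ℝ,
      X ≤ N / E N * (γ / 72 *
        (γ / 8 * Real.logb 2 (1 / (16 / (γ * Λ))) - 2 - Real.logb 2 (1 / (γ / 8)))) →
      γ / 4 ≤ μ.real {ω | X ≤ (S.bits ω σ : ℝ)} := by
  set Y := γ / 8 * Real.logb 2 (1 / (16 / (γ * Λ))) - 2 - Real.logb 2 (1 / (γ / 8)) with hYdef
  have hEpos : ∀ N, 0 < E N := fun N => one_pos.trans_le (hE1 N)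
  have hΛ0 : (0 : ℝ) < Λ := lt_of_lt_of_le (by positivity) hΛ
  have hΛn : 0 < Λ := by exact_mod_cast hΛ0
  have hUc : (0 : ℝ) < U.card := by
    have : (0 : ℝ) < γ / 8 * U.card := lt_of_lt_of_le (by positivity) hU
    exact pos_of_mul_pos_right this (by positivity)
  have hUne : U.Nonempty := Finset.card_pos.1 (by exact_mod_cast hUc)
  have hζ : 0 < 16 / (γ * Λ) := by positivity
  have hζ1 : 16 / (γ * Λ) ≤ 1 := by
    rw [div_le_iff₀ hγ] at hΛ
    rw [div_le_one (by positivity)]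
    linarith
  set F := E (2 ^ (i + 1)) with hF
  have hF0 : 0 < F := hEpos _
  have hFi : E (2 ^ i) ≤ F := hmono (Nat.pow_le_pow_right (by norm_num) (Nat.le_succ i))
  have hB0 : (0 : ℝ) < (Λ : ℝ) ^ Λ := by positivity
  -- The choice makes `E / (κ * b ^ D)` at most `γ / 8` for `b = D = Λ`. Since `Λ ^ Λ ≤ E (2 ^ i)`,
  -- rounding up to an integer costs only a constant factor; this is where a large error bound is
  -- needed.
  set κ := ⌈8 * F / (γ * (Λ : ℝ) ^ Λ)⌉₊ with hκ
  have hκ0 : 0 < κ := Nat.ceil_pos.2 (by positivity)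
  have hκR : (0 : ℝ) < κ := by exact_mod_cast hκ0
  have hκ1 : 8 * F / γ ≤ κ * (Λ : ℝ) ^ Λ := by
    rw [← div_le_iff₀ hB0, div_div]
    exact Nat.le_ceil _
  have hFγ : F ≤ F / γ := by
    rw [le_div_iff₀ hγ]
    nlinarith
  have hκ2 : κ * (Λ : ℝ) ^ Λ ≤ 18 * E (2 ^ i) / γ := by
    have h1 : (κ : ℝ) ≤ 8 * F / (γ * (Λ : ℝ) ^ Λ) + 1 := (Nat.ceil_lt_add_one (by positivity)).le
    have h2 := mul_le_mul_of_nonneg_right h1 hB0.le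
    have h3 : (8 * F / (γ * (Λ : ℝ) ^ Λ) + 1) * (Λ : ℝ) ^ Λ = 8 * (F / γ) + (Λ : ℝ) ^ Λ := by
      field_simp
    have h4 : F / γ ≤ 2 * E (2 ^ i) / γ := div_le_div_of_nonneg_right hflat hγ.le
    have h5 : 18 * E (2 ^ i) / γ = 9 * (2 * E (2 ^ i) / γ) := by ring
    rw [h3] at h2
    linarith
  set B := Λ * (κ * Λ ^ Λ) with hB
  have hBpos : 0 < B := by positivity
  have hBle : B ≤ 2 ^ i := by
    have : (B : ℝ) ≤ 2 ^ i := by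
      rw [hB]
      push_cast
      refine (mul_le_mul_of_nonneg_left hκ2 hΛ0.le).trans (le_trans (le_of_eq ?_) hi)
      ring
    exact_mod_cast this
  set m := 2 ^ i / B with hm
  have hm0 : 0 < m := Nat.div_pos hBle hBpos
  have hmB : Λ * m * (κ * Λ ^ Λ) ≤ 2 ^ i := by
    calc Λ * m * (κ * Λ ^ Λ) = m * B := by rw [hB]; ring
      _ ≤ 2 ^ i := Nat.div_mul_le_self _ _
  have hmB2 : 2 ^ i ≤ 2 * (Λ * m * (κ * Λ ^ Λ)) := by
    have h1 : 2 ^ i < m * B + B := Nat.lt_div_mul_add hBpos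
    have h2 : B ≤ m * B := Nat.le_mul_of_pos_left _ hm0
    have h3 : Λ * m * (κ * Λ ^ Λ) = m * B := by rw [hB]; ring
    omega
  have hend : 2 ^ i + Λ * m * (κ * Λ ^ Λ) ≤ 2 ^ (i + 1) := by
    rw [pow_succ]; omega
  -- With `b = D` the two sources of new keys, heights and growth, contribute equally, and `ζ` makes
  -- their joint loss `γ / 8`.
  obtain ⟨σ, hσ1, hσ2, hp⟩ := exists_stream_of_tree hS hE hUne hΛn hΛn hm0 hκ0 (2 ^ i)
    (hEpos _).le (16 / (γ * Λ)) (γ / 8) (γ / 8) hζ hζ1 (by positivity) _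
    (two_pow_ceil_mul_le (Nat.mul_pos hΛn hm0) hζ (by positivity) (by linarith) hY)
  have hσ3 : σ.length ≤ 2 ^ (i + 1) := hσ2.trans hend
  refine ⟨σ.length, hσ1, hσ3, σ, rfl, fun X hX => ?_⟩
  refine measure_le_bits_mono σ rfl (hX.trans ?_) (le_trans ?_ hp)
  · rw [← mul_assoc]
    refine mul_le_mul_of_nonneg_right ?_ hY
    have h1 : E (2 ^ i) ≤ E σ.length := hmono hσ1
    have h2 : (σ.length : ℝ) ≤ 2 * 2 ^ i := by
      have : (σ.length : ℝ) ≤ 2 ^ (i + 1) := by exact_mod_cast hσ3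
      rwa [pow_succ, mul_comm] at this
    have h3 : (2 : ℝ) ^ i ≤ 2 * (((Λ * m : ℕ) : ℝ) * (κ * (Λ : ℝ) ^ Λ)) := by
      exact_mod_cast hmB2
    have h4 := mul_le_mul_of_nonneg_left hκ2 (Nat.cast_nonneg (α := ℝ) (Λ * m))
    have h5 : ((Λ * m : ℕ) : ℝ) * (18 * E (2 ^ i) / γ) ≤
        ((Λ * m : ℕ) : ℝ) * (18 * E σ.length / γ) := by
      refine mul_le_mul_of_nonneg_left ?_ (Nat.cast_nonneg _)
      exact div_le_div_of_nonneg_right (by linarith) hγ.le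
    rw [div_mul_eq_mul_div, div_le_iff₀ (hEpos _)]
    have h6 : (σ.length : ℝ) ≤ 4 * (((Λ * m : ℕ) : ℝ) * (18 * E σ.length / γ)) := by linarith
    have h7 : 4 * (((Λ * m : ℕ) : ℝ) * (18 * E σ.length / γ)) * (γ / 72) =
        ((Λ * m : ℕ) : ℝ) * E σ.length := by
      field_simp
      ring
    rw [← h7]
    exact mul_le_mul_of_nonneg_right h6 (by positivity)
  · have h1 : (1 + (Λ : ℝ) / Λ) / (Λ * (16 / (γ * Λ))) = γ / 8 := by
      field_simp
      ring
    have h2 : ((2 ^ i + Λ * m * (κ * Λ ^ Λ) : ℕ) : ℝ) / U.card ≤ γ / 8 := by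
      rw [div_le_iff₀ hUc]
      exact le_trans (by exact_mod_cast hend) hU
    have h3 : E (2 ^ i + Λ * m * (κ * Λ ^ Λ)) / (κ * (Λ : ℝ) ^ Λ) ≤ γ / 8 := by
      have h4 : E (2 ^ i + Λ * m * (κ * Λ ^ Λ)) ≤ F := hmono hend
      rw [div_le_iff₀ (by positivity)]
      rw [div_le_iff₀ hγ] at hκ1
      linarith
    rw [h1]
    linarith

end FESketch

/-! ### Rounding of the iterated logarithm -/

section Threshold

/-- `Λ` is the integer fourth root of `⌊L / 8⌋`. Rounding loses at most a factor 2 in `Λ`, hence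
only a constant in the logarithm. The factor 8 arises because `L` is four times the logarithm of the
fourth root of the density, which has to be at least `2 * Λ ^ 4`. -/
theorem exists_nat_pow_four {L : ℝ} (hL : 8 ≤ L) :
    ∃ Λ : ℕ, 1 ≤ Λ ∧ 8 * (Λ : ℝ) ^ 4 ≤ L ∧ Real.logb 2 L ≤ 7 + 4 * Real.logb 2 Λ := by
  set m := ⌊L / 8⌋₊ with hm
  set Λ := Nat.sqrt (Nat.sqrt m) with hΛ
  have hm1 : 1 ≤ m := Nat.le_floor (by push_cast; linarith)
  have hs1 : 1 ≤ Nat.sqrt m := Nat.le_sqrt.2 (by omega)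
  have hΛ1 : 1 ≤ Λ := Nat.le_sqrt.2 (by omega)
  have hlow : Λ ^ 4 ≤ m := by
    calc Λ ^ 4 = (Λ ^ 2) ^ 2 := by ring
      _ ≤ Nat.sqrt m ^ 2 := Nat.pow_le_pow_left (Nat.sqrt_le' _) 2
      _ ≤ m := Nat.sqrt_le' m
  have hhigh : m + 1 ≤ (2 * Λ) ^ 4 := by
    have h1 : Nat.sqrt m + 1 ≤ (Λ + 1) ^ 2 := Nat.lt_succ_sqrt' _
    calc m + 1 ≤ (Nat.sqrt m + 1) ^ 2 := Nat.lt_succ_sqrt' m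
      _ ≤ ((Λ + 1) ^ 2) ^ 2 := Nat.pow_le_pow_left h1 2
      _ = (Λ + 1) ^ 4 := by ring
      _ ≤ (2 * Λ) ^ 4 := Nat.pow_le_pow_left (by omega) 4
  have hΛR : (0 : ℝ) < Λ := by exact_mod_cast hΛ1
  refine ⟨Λ, hΛ1, ?_, ?_⟩
  · have h1 : (m : ℝ) ≤ L / 8 := Nat.floor_le (by linarith)
    have h2 : (Λ : ℝ) ^ 4 ≤ m := by exact_mod_cast hlow
    linarith
  · have h1 : L / 8 < m + 1 := Nat.lt_floor_add_one _
    have h2 : (m : ℝ) + 1 ≤ (2 * Λ) ^ 4 := by exact_mod_cast hhigh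
    have h3 : L ≤ 2 ^ (7 : ℕ) * (Λ : ℝ) ^ 4 := by
      have : (2 * (Λ : ℝ)) ^ 4 = 16 * (Λ : ℝ) ^ 4 := by ring
      linarith
    calc Real.logb 2 L ≤ Real.logb 2 (2 ^ (7 : ℕ) * (Λ : ℝ) ^ 4) :=
          Real.logb_le_logb_of_le (by norm_num) (by linarith) h3
      _ = 7 + 4 * Real.logb 2 Λ := by
          rw [Real.logb_mul (by positivity) (by positivity), Real.logb_pow, Real.logb_pow,
            Real.logb_self_eq_one (by norm_num)]
          push_cast
          ring

/-- The additive loss in the `log log` bound at confidence `γ`. -/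
noncomputable def logLoss (γ : ℝ) : ℝ :=
  γ / 8 * Real.logb 2 (16 / γ) + 2 + Real.logb 2 (8 / γ)

theorem logLoss_nonneg {γ : ℝ} (hγ : 0 < γ) (hγ1 : γ < 1) : 0 ≤ logLoss γ := by
  have h1 : 0 ≤ Real.logb 2 (16 / γ) :=
    Real.logb_nonneg (by norm_num) ((one_le_div hγ).2 (by linarith))
  have h2 : 0 ≤ Real.logb 2 (8 / γ) :=
    Real.logb_nonneg (by norm_num) ((one_le_div hγ).2 (by linarith))
  unfold logLoss
  positivity

theorem logb_sub_eq_sub_logLoss {γ Λ : ℝ} (hγ : 0 < γ) (hΛ : 0 < Λ) :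
    γ / 8 * Real.logb 2 (1 / (16 / (γ * Λ))) - 2 - Real.logb 2 (1 / (γ / 8)) =
      γ / 8 * Real.logb 2 Λ - logLoss γ := by
  have h1 : 1 / (16 / (γ * Λ)) = Λ / (16 / γ) := by field_simp
  rw [h1, one_div_div, Real.logb_div hΛ.ne' (by positivity), logLoss]
  ring

end Threshold

/-! ### The `log log` bound -/

namespace FESketch

variable {K Ω : Type*} [MeasurableSpace Ω] [DecidableEq K] {S : FESketch K Ω} {μ : Measure Ω}
  [IsProbabilityMeasure μ] {E : ℕ → ℝ} {δ : ℝ}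

/-- The `log log (N / E N)` bound. -/
theorem exists_stream_logb_logb (hS : S.NeverUnderestimates μ) (hE : S.HasErrorBound μ E δ)
    (hmono : Monotone E) (hE1 : ∀ N, 1 ≤ E N) {γ : ℝ} (hγ : 0 < γ) (hγ1 : γ < 1)
    (hδ : γ ≤ 1 - δ) {N₁ : ℕ} {U : Finset K} (hU : (N₁ : ℝ) ≤ U.card) (hN₁ : E N₁ < N₁)
    (hlog : 7 + 4 * (8 * logLoss γ / γ + 64 / γ) ≤ Real.logb 2 (Real.logb 2 (N₁ / E N₁))) :
    ∃ N ≤ N₁, Real.sqrt (N₁ / E N₁) ≤ N / E N ∧ ∃ σ : List K, σ.length = N ∧ ∀ X : ℝ,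
      X ≤ N / E N *
        (γ / 72 * (γ / 32 * (Real.logb 2 (Real.logb 2 (N₁ / E N₁)) - 7) - logLoss γ)) →
      γ / 4 ≤ μ.real {ω | X ≤ (S.bits ω σ : ℝ)} := by
  have hEpos : ∀ N, 0 < E N := fun N => one_pos.trans_le (hE1 N)
  set M := (N₁ : ℝ) / E N₁ with hM
  have hM1 : 1 < M := (one_lt_div (hEpos N₁)).2 hN₁
  have hL0 : 0 < Real.logb 2 M := Real.logb_pos (by norm_num) hM1
  have hloss := logLoss_nonneg hγ hγ1
  have h64 : 64 ≤ 64 / γ := (le_div_iff₀ hγ).2 (by linarith)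
  have hloss' : 0 ≤ 8 * logLoss γ / γ := by positivity
  have hL8 : 8 ≤ Real.logb 2 M := by
    have h1 : (3 : ℝ) ≤ Real.logb 2 (Real.logb 2 M) := by linarith
    rw [Real.le_logb_iff_rpow_le (by norm_num) hL0] at h1
    norm_num at h1
    exact h1
  obtain ⟨Λ, hΛ1, hΛ4, hΛlog⟩ := exists_nat_pow_four hL8
  have hΛ0 : (0 : ℝ) < Λ := by exact_mod_cast hΛ1
  have hlogΛ : 8 * logLoss γ / γ + 64 / γ ≤ Real.logb 2 Λ := by linarith
  have hlogle : Real.logb 2 Λ ≤ Λ := by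
    rw [Real.logb_le_iff_le_rpow (by norm_num) hΛ0, Real.rpow_natCast]
    exact_mod_cast Nat.lt_two_pow_self.le
  have hΛ64 : 64 / γ ≤ Λ := by linarith
  have hΛ16 : 16 / γ ≤ Λ := le_trans (div_le_div_of_nonneg_right (by norm_num) hγ.le) hΛ64
  have hΛ2 : 2 ≤ Λ := by
    have : (2 : ℝ) ≤ Λ := by linarith
    exact_mod_cast this
  have hYeq := logb_sub_eq_sub_logLoss hγ hΛ0
  set Y := γ / 8 * Real.logb 2 (1 / (16 / (γ * Λ))) - 2 - Real.logb 2 (1 / (γ / 8)) with hYdef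
  have hYge : γ / 32 * (Real.logb 2 (Real.logb 2 M) - 7) - logLoss γ ≤ Y := by
    have := mul_le_mul_of_nonneg_left hΛlog (by positivity : 0 ≤ γ / 32)
    rw [hYeq]
    linarith
  have hY : 0 ≤ Y := by
    rw [hYeq]
    have h1 : 8 * logLoss γ / γ ≤ Real.logb 2 Λ := by linarith [(by positivity : 0 < 64 / γ)]
    rw [div_le_iff₀ hγ] at h1
    linarith
  -- the fourth root of the density
  set x := Real.sqrt (Real.sqrt M) with hxdef
  have hx0 : 0 ≤ x := Real.sqrt_nonneg _
  have hx2 : x ^ 2 = Real.sqrt M := Real.sq_sqrt (Real.sqrt_nonneg M)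
  have hx4 : x ^ 4 = M := by
    calc x ^ 4 = (x ^ 2) ^ 2 := by ring
      _ = M := by rw [hx2, Real.sq_sqrt (by linarith)]
  have hxΛ : (2 : ℝ) ^ (2 * Λ ^ 4) ≤ x := by
    refine le_of_pow_le_pow_left₀ (n := 4) (by norm_num) hx0 ?_
    rw [hx4, ← pow_mul, ← Real.rpow_natCast, ← Real.le_logb_iff_rpow_le (by norm_num) (by linarith)]
    push_cast
    linarith
  have hxsq : (Λ : ℝ) * Λ ≤ x := by
    refine le_trans ?_ hxΛ
    have h1 : Λ * Λ ≤ 2 * Λ ^ 4 := by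
      calc Λ * Λ = Λ ^ 2 := (sq Λ).symm
        _ ≤ Λ ^ 4 := Nat.pow_le_pow_right hΛ1 (by norm_num)
        _ ≤ 2 * Λ ^ 4 := Nat.le_mul_of_pos_left _ (by norm_num)
    exact_mod_cast h1.trans Nat.lt_two_pow_self.le
  have hx64 : 64 / γ * Λ ≤ x := (mul_le_mul_of_nonneg_right hΛ64 hΛ0.le).trans hxsq
  have hx16 : 64 / γ ≤ x :=
    (le_mul_of_one_le_right (by positivity) (by exact_mod_cast hΛ1)).trans hx64
  have hxpos : 0 < x := lt_of_lt_of_le (by positivity) hx16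
  have hxU : ∀ j : ℕ, x * 2 ^ j ≤ N₁ → (2 : ℝ) ^ (j + 1) ≤ γ / 8 * U.card := by
    intro j hj
    have h1 : 64 / γ * 2 ^ j ≤ U.card :=
      (mul_le_mul_of_nonneg_right hx16 (by positivity)).trans (hj.trans hU)
    rw [div_mul_eq_mul_div, div_le_iff₀ hγ] at h1
    rw [pow_succ]
    linarith [(by positivity : (0 : ℝ) < 2 ^ j)]
  have hxN : x ^ 4 * E N₁ = N₁ := by rw [hx4, hM, div_mul_cancel₀ _ (hEpos N₁).ne']
  rw [← hx2]
  -- A density known at the left end of a window survives throughout it up to a factor 2.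
  have hratio : ∀ {i j N : ℕ} {a : ℝ}, 0 ≤ a → E (2 ^ j) ≤ 2 * E (2 ^ i) →
      a * E (2 ^ i) ≤ 2 ^ i → 2 ^ i ≤ N → N ≤ 2 ^ j → a / 2 ≤ N / E N := by
    intro i j N a ha h1 h2 h3 h4
    rw [le_div_iff₀ (hEpos N)]
    have h5 : E N ≤ 2 * E (2 ^ i) := (hmono h4).trans h1
    have h6 : ((2 ^ i : ℕ) : ℝ) ≤ N := by exact_mod_cast h3
    push_cast at h6
    have h7 := mul_le_mul_of_nonneg_left h5 ha
    linarith
  rcases flat_window_or_large hmono hE1 hΛ2 hxΛ hxN with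
    ⟨i, hflat, hlow, hi⟩ | ⟨i, hflat, hlow, hi, hi1, hlarge⟩
  · have hx2pos : 1 ≤ x ^ 2 := one_le_pow₀ (by linarith)
    have h4 : 4 * E (2 ^ i) ≤ 2 ^ i := by
      have := mul_le_mul_of_nonneg_right hx2pos (hEpos (2 ^ i)).le
      linarith
    have hwin : (2 : ℝ) ^ (i + Λ ^ 2) ≤ γ / 8 * U.card :=
      le_trans (pow_le_pow_right₀ (by norm_num) (Nat.le_succ _)) (hxU _ hi)
    obtain ⟨N, hN1, hN2, σ, hσ, hp⟩ := exists_stream_of_flat_window hS hE hmono hE1 hγ hγ1 hδ hΛ16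
      (Nat.le_self_pow (by norm_num) Λ) hflat h4 hwin hY
    refine ⟨N, hN2.trans ?_, ?_, σ, hσ, fun X hX => hp X (hX.trans ?_)⟩
    · have : (2 : ℝ) ^ (i + Λ ^ 2) ≤ N₁ :=
        (le_mul_of_one_le_left (by positivity) (by linarith)).trans hi
      exact_mod_cast this
    · have := hratio (by positivity) hflat hlow.le hN1 hN2
      linarith
    · refine mul_le_mul_of_nonneg_left ?_ (div_nonneg (Nat.cast_nonneg _) (hEpos N).le)
      exact (mul_le_mul_of_nonneg_left hYge (by positivity)).trans
        (mul_le_mul_of_nonneg_right (by linarith) hY)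
  · have hpow : (Λ : ℝ) ^ Λ ≤ E (2 ^ i) := by
      refine le_trans ?_ hlarge
      have h1 : Λ ^ Λ ≤ 2 ^ Λ ^ 2 := by
        calc Λ ^ Λ ≤ (2 ^ Λ) ^ Λ := Nat.pow_le_pow_left Nat.lt_two_pow_self.le Λ
          _ = 2 ^ Λ ^ 2 := by rw [← pow_mul, sq]
      exact_mod_cast h1
    have hx1 : 1 ≤ x := by linarith
    have h18 : 18 * Λ / γ * E (2 ^ i) ≤ 2 ^ i := by
      have h1 : 18 * Λ / γ ≤ x ^ 3 / 2 := by
        have h2 : x ≤ x ^ 3 := le_self_pow₀ hx1 (by norm_num)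
        have h3 : 18 * Λ / γ = 9 / 32 * (64 / γ * Λ) := by ring
        rw [h3]
        linarith
      have := mul_le_mul_of_nonneg_right h1 (hEpos (2 ^ i)).le
      linarith
    obtain ⟨N, hN1, hN2, σ, hσ, hp⟩ := exists_stream_of_large_error hS hE hmono hE1 hγ hγ1 hδ hΛ16
      hpow hflat h18 (hxU _ hi) hY
    refine ⟨N, hN2.trans hi1, ?_, σ, hσ, fun X hX => hp X (hX.trans ?_)⟩
    · have h1 := hratio (a := x ^ 3 / 2) (by positivity) hflat (by linarith) hN1 hN2
      have h2 : x ^ 3 / 2 / 2 = x ^ 2 * (x / 4) := by ring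
      rw [h2] at h1
      exact (le_mul_of_one_le_right (by positivity) (by linarith)).trans h1
    · refine mul_le_mul_of_nonneg_left ?_ (div_nonneg (Nat.cast_nonneg _) (hEpos N).le)
      exact mul_le_mul_of_nonneg_left hYge (by positivity)

end FESketch

/-! ### Combination of the two bounds -/

theorem mainTheorem4 (δ₀ : ℝ) (hδ₀ : δ₀ < 1) :
    ∃ c C p : ℝ, 0 < c ∧ 0 < C ∧ 0 < p ∧
      ∀ (K : Type*) [DecidableEq K] (Ω : Type*) [MeasurableSpace Ω]
        (μ : Measure Ω) [IsProbabilityMeasure μ] (S : FESketch K Ω) (E : ℕ → ℝ) (δ : ℝ),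
        0 < δ → δ ≤ δ₀ → Monotone E → (∀ N, 1 ≤ E N) →
        S.NeverUnderestimates μ → S.HasErrorBound μ E δ →
        ∀ N₁ : ℕ, E N₁ < N₁ → (∃ U : Finset K, (N₁ : ℝ) / δ ≤ (U.card : ℝ)) →
          ∃ N : ℕ, N ≤ N₁ ∧ Real.sqrt ((N₁ : ℝ) / E N₁) ≤ (N : ℝ) / E N ∧
            ∃ σ : List K, σ.length = N ∧
              p ≤ μ.real {ω | (N : ℝ) / E N *
                (c * (Real.logb 2 (1 / δ) + Real.logb 2 (Real.logb 2 ((N : ℝ) / E N))) - C)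
                  ≤ (S.bits ω σ : ℝ)} := by
  rcases le_or_gt δ₀ 0 with hneg | hpos
  · exact ⟨1, 1, 1, one_pos, one_pos, one_pos,
      fun K _ Ω _ μ _ S E δ h1 h2 => absurd (h1.trans_le h2) (not_lt.2 hneg)⟩
  set γ := 1 - δ₀ with hγdef
  have hγ : 0 < γ := by linarith
  have hγ1 : γ < 1 := by linarith
  have hloss := logLoss_nonneg hγ hγ1
  -- Since 26 is 7 + 19, exceeding `W` meets the thresholds of both bounds at once.
  set W := 26 + 4 * (8 * logLoss γ / γ + 64 / γ) with hW
  have hW26 : 26 ≤ W := by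
    -- Below, 4608 is `2 * 72 * 32`: the factors of the `log log` bound, halved because a sum of two
    -- logarithms is at most twice the larger. The term `2 * c * W` in `C` forces the larger one
    -- above `W` whenever the claimed bound is positive.
    have : 0 ≤ 4 * (8 * logLoss γ / γ + 64 / γ) := by positivity
    linarith
  set c := γ ^ 2 / 4608 with hc
  have hc0 : 0 < c := by positivity
  have hc1 : c ≤ 1 / 32 := by
    have : γ ^ 2 ≤ 1 := pow_le_one₀ hγ.le hγ1.le
    linarith
  set C := 2 * c * W + 2 + γ / 72 * (7 * γ / 32 + logLoss γ) with hC
  have htail : 0 ≤ γ / 72 * (7 * γ / 32 + logLoss γ) := by positivity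
  have hcW : 0 < c * W := by positivity
  refine ⟨c, C, γ / 4, hc0, by linarith, by positivity, ?_⟩
  intro K _ Ω _ μ _ S E δ hδ hδδ₀ hmono hE1 hS hE N₁ hN₁ ⟨U, hU⟩
  have hEpos : ∀ N, 0 < E N := fun N => one_pos.trans_le (hE1 N)
  have hδ1 : δ < 1 := hδδ₀.trans_lt hδ₀
  -- a length of maximal density
  obtain ⟨N', hN'mem, hmax⟩ := Finset.exists_max_image (Finset.range (N₁ + 1))
    (fun N => (N : ℝ) / E N) ⟨0, Finset.mem_range.2 (Nat.succ_pos _)⟩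
  have hN' : N' ≤ N₁ := Nat.lt_succ_iff.1 (Finset.mem_range.1 hN'mem)
  have hmax' : ∀ N ≤ N₁, (N : ℝ) / E N ≤ N' / E N' := fun N hN =>
    hmax N (Finset.mem_range.2 (Nat.lt_succ_of_le hN))
  have hM₁ : (N₁ : ℝ) / E N₁ ≤ N' / E N' := hmax' N₁ le_rfl
  have hM : 1 < (N' : ℝ) / E N' := ((one_lt_div (hEpos N₁)).2 hN₁).trans_le hM₁
  have hEN' : E N' < N' := (one_lt_div (hEpos N')).1 hM
  have hsqrt : Real.sqrt ((N₁ : ℝ) / E N₁) ≤ Real.sqrt (N' / E N') := Real.sqrt_le_sqrt hM₁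
  have hsqrtM : Real.sqrt ((N' : ℝ) / E N') ≤ N' / E N' :=
    Real.sqrt_le_iff.2 ⟨by linarith, le_self_pow₀ hM.le two_ne_zero⟩
  have hU' : (N' : ℝ) / δ ≤ U.card :=
    (div_le_div_of_nonneg_right (by exact_mod_cast hN') hδ.le).trans hU
  have hN'U : (N' : ℝ) ≤ U.card :=
    ((le_div_iff₀ hδ).2 (mul_le_of_le_one_right (Nat.cast_nonneg _) hδ1.le)).trans hU'
  set ℓ := Real.logb 2 (1 / δ) with hℓ
  set ℓ' := Real.logb 2 (Real.logb 2 ((N' : ℝ) / E N')) with hℓ'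
  rcases le_or_gt (c * (ℓ + ℓ') - C) 0 with hbr | hbr
  · -- the claimed bound is not positive
    have hUne : U.Nonempty := by
      refine Finset.card_pos.1 ?_
      have : (0 : ℝ) < U.card := (hEpos N').trans (hEN'.trans_le hN'U)
      exact_mod_cast this
    obtain ⟨z, -⟩ := hUne
    refine ⟨N', hN', hsqrt.trans hsqrtM, List.replicate N' z, List.length_replicate, ?_⟩
    have huniv : {ω | (N' : ℝ) / E N' * (c * (ℓ + ℓ') - C) ≤
        (S.bits ω (List.replicate N' z) : ℝ)} = Set.univ := by
      refine Set.eq_univ_of_forall fun ω => ?_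
      exact (mul_nonpos_of_nonneg_of_nonpos (by linarith) hbr).trans (Nat.cast_nonneg _)
    rw [huniv, probReal_univ]
    linarith
  rcases le_or_gt ℓ' ℓ with hcase | hcase
  · have h1 : c * (ℓ + ℓ') ≤ c * (2 * ℓ) := mul_le_mul_of_nonneg_left (by linarith) hc0.le
    have hWℓ : W < ℓ := lt_of_mul_lt_mul_left (by linarith : c * W < c * ℓ) hc0.le
    obtain ⟨σ, hσ, hp⟩ := FESketch.exists_stream_logb_inv hS hE hE1 hδ (by linarith) hEN' hU'
      (X := (N' : ℝ) / E N' * (c * (ℓ + ℓ') - C)) (by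
        refine mul_le_mul_of_nonneg_left ?_ (by linarith)
        have := mul_le_mul_of_nonneg_right hc1 (by linarith : 0 ≤ ℓ)
        linarith)
    exact ⟨N', hN', hsqrt.trans hsqrtM, σ, hσ, le_trans (by linarith) hp⟩
  · have h1 : c * (ℓ + ℓ') ≤ c * (2 * ℓ') := mul_le_mul_of_nonneg_left (by linarith) hc0.le
    have hWℓ : W < ℓ' := lt_of_mul_lt_mul_left (by linarith : c * W < c * ℓ') hc0.le
    obtain ⟨N, hN, hNd, σ, hσ, hp⟩ := FESketch.exists_stream_logb_logb hS hE hmono hE1 hγ hγ1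
      (by linarith) hN'U hEN' (by linarith)
    refine ⟨N, hN.trans hN', hsqrt.trans hNd, σ, hσ, hp _ ?_⟩
    have hNE : 1 < (N : ℝ) / E N := by
      refine lt_of_lt_of_le ?_ hNd
      rw [Real.lt_sqrt (by norm_num)]
      linarith
    -- Maximality of the density at `N'` is needed here: the claim involves the density at `N`,
    -- which may exceed that at `N₁`.
    have hlog : Real.logb 2 (Real.logb 2 ((N : ℝ) / E N)) ≤ ℓ' :=
      Real.logb_le_logb_of_le (by norm_num) (Real.logb_pos (by norm_num) hNE)
        (Real.logb_le_logb_of_le (by norm_num) (by linarith) (hmax' N (hN.trans hN')))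
    refine mul_le_mul_of_nonneg_left ?_ (by linarith)
    have h2 := mul_le_mul_of_nonneg_left hlog hc0.le
    have h3 : γ / 72 * (γ / 32 * (ℓ' - 7) - logLoss γ) =
        c * (2 * ℓ') - γ / 72 * (7 * γ / 32 + logLoss γ) := by
      rw [hc]; ring
    rw [h3]
    linarith
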